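/- Let $n\in\mathbb{N}$ and let $\mathbb{CH}^n=\mathbb{B}^n=\{z\in\mathbb{C}^n:|z|<1\}$, with $\operatorname{Aut}(\mathbb{B}^n)$ the group of biholomorphic self-maps. A *complex geodesic* is the image under an element of $\operatorname{Aut}(\mathbb{B}^n)$ of the slice $\{(z,0,\dots,0):|z|<1\}$. Let $Y=(y_1,y_2,y_3)$ be an ordered triple of distinct points of $\mathbb{CH}^n$. *Normal form.* Let $\mathcal N$ be the set of triples $X=(x_1,x_2,x_3)=((0,0),(s,0),(w,t))$ in $\mathbb{B}^2$ with $s>0$, $t\ge 0$, $w\in\mathbb{C}$, and $\mathcal E=\{X\in\mathcal N:t=0\}$. A normal form of $Y$ is a triple $X\in\mathcal N$ such that some $\Phi\in\operatorname{Aut}(\mathbb{B}^n)$ has $\Phi(y_j)=x_j$ for $j=1,2,3$, where points of $\mathbb{B}^n$ and $\mathbb{B}^2$ are identified if their coordinates, continued by zeros, agree. $Y$ has exactly one normal form; denote it by $X$. *The space.* Let $DA_2$ be the reproducing kernel Hilbert space on $\mathbb{B}^2$ with kernel functions $k_w(z)=(1-(z,w))^{-1}$, $(z,w)=\sum_i z_i\overline{w_i}$.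 Let $H=DA_2(X)$ be the span in $DA_2$ of $k_i=k_{x_i}$, $i=1,2,3$, regarded as a space of functions on $X$, and put $k_{ij}=\langle k_i,k_j\rangle=k_{x_i}(x_j)$, $$\delta_{ij}=\Bigl(1-\frac{|k_{ij}|^2}{k_{ii}k_{jj}}\Bigr)^{1/2},\qquad LF_{123}^2=\frac1{\delta_{12}^2}\left|1-\frac{k_{21}k_{13}}{k_{23}k_{11}}\right|^2 .$$ A multiplier of $H$ is a function $m:X\to\mathbb{C}$ for which $(M_mh)(x)=m(x)h(x)$ defines a bounded operator $M_m$ on $H$; $\|m\|$ is the operator norm of $M_m$. Put $$\Delta_G=\sup\{\operatorname{Re}m(x_1): m(x_2)=m(x_3)=0,\ \|m\|\le 1\},$$ $$\Delta_H=\|k_1\|^{-1}\sup\{\operatorname{Re}h(x_1):h\in H,\ h(x_2)=h(x_3)=0,\ \|h\|\le1\}.$$ *Extremal multipliers.* Each of the following multipliers of norm one exists and is unique: for $i=2,3$, the multiplier $M_i$ that vanishes at $x_1$ and maximizes $\operatorname{Re}M_i(x_i)$ among the multipliers of norm one that vanish at $x_1$; for $i=2,3$, the multiplier $m_i$ that vanishes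 at $x_i$ and maximizes $\operatorname{Re}m_i(x_1)$ among those that vanish at $x_i$; the multiplier $m_{23}$ that vanishes at $x_2$ and $x_3$ and maximizes $\operatorname{Re}m_{23}(x_1)$ among those that vanish at $x_2$ and $x_3$. **Proposition.** With this notation the following are equivalent: 1. the points of $Y$ lie in a single complex geodesic; 2. $X\in\mathcal E$; 3. $LF_{123}^2=\delta_{13}^2$; 4. $M_2=\alpha M_3$ for some $\alpha\in\mathbb{C}$ with $|\alpha|=1$; 5. $m_{23}=m_2m_3$; 6. $\|m_2m_3\|=1$; 7. $\Delta_G=\delta_{12}\delta_{13}$; 8. $\Delta_H=\delta_{12}\delta_{13}$. -/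

import Mathlib

noncomputable section

open scoped ComplexOrder

namespace DruryArveson

/-! ## The ball model of complex hyperbolic space -/

/-- Complex hyperbolic `n`-space: the open unit ball of `ℂⁿ` with its Euclidean norm. -/
abbrev Ball (n : ℕ) : Type := ↥(Metric.ball (0 : EuclideanSpace ℂ (Fin n)) 1)

/-- A map between balls is holomorphic if it is the restriction of a map that is
complex differentiable on the open ball. -/
def IsHolomorphicMap {n : ℕ} (f : Ball n → Ball n) : Prop :=
  ∃ F : EuclideanSpace ℂ (Fin n) → EuclideanSpace ℂ (Fin n),
    DifferentiableOn ℂ F (Metric.ball 0 1) ∧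
      ∀ z : Ball n, F (z : EuclideanSpace ℂ (Fin n)) = (f z : EuclideanSpace ℂ (Fin n))

/-- `Φ ∈ Aut(𝔹ⁿ)`: a biholomorphic self-map of the ball. -/
def IsBallAut {n : ℕ} (Φ : Ball n ≃ Ball n) : Prop :=
  IsHolomorphicMap Φ ∧ IsHolomorphicMap Φ.symm

/-- The model complex geodesic `{(z, 0, …, 0) : |z| < 1}`. -/
def horizontalSlice (n : ℕ) : Set (Ball n) :=
  {z | ∀ i : Fin n, (i : ℕ) ≠ 0 → (z : EuclideanSpace ℂ (Fin n)) i = 0}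

/-- Complex geodesics: the images of the model one under the automorphism group. -/
def IsComplexGeodesic {n : ℕ} (G : Set (Ball n)) : Prop :=
  ∃ Φ : Ball n ≃ Ball n, IsBallAut Φ ∧ G = Φ '' horizontalSlice n

/-! ## Normal forms of triples -/

/-- The `i`-th coordinate (counted from `0`) of a point of the ball,
the coordinates being continued by zero. -/
def coord {n : ℕ} (z : Ball n) (i : ℕ) : ℂ :=
  if h : i < n then (z : EuclideanSpace ℂ (Fin n)) ⟨i, h⟩ else 0

/-- The triple is `(0,0), (s,0), (w,t)`. -/
def HasNormalCoords (x : Fin 3 → Ball 2) (s t : ℝ) (w : ℂ) : Prop :=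
  (x 0 : EuclideanSpace ℂ (Fin 2)) = !₂[0, 0] ∧
  (x 1 : EuclideanSpace ℂ (Fin 2)) = !₂[(s : ℂ), 0] ∧
  (x 2 : EuclideanSpace ℂ (Fin 2)) = !₂[w, (t : ℂ)]

/-- The class `𝒩` of triples in normal form. -/
def ClassN (x : Fin 3 → Ball 2) : Prop :=
  ∃ (s t : ℝ) (w : ℂ), 0 < s ∧ 0 ≤ t ∧ HasNormalCoords x s t w

/-- The class `ℰ`: triples in normal form with `t = 0`. -/
def ClassE (x : Fin 3 → Ball 2) : Prop :=
  ∃ (s : ℝ) (w : ℂ), 0 < s ∧ HasNormalCoords x s 0 w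

/-- `x` is the normal form of the ordered triple `y` in `ℂℍⁿ`: it lies in `𝒩`, and some
automorphism of the ball `𝔹ⁿ` carries `y` to `x`. A point of `𝔹ⁿ` and a point of `𝔹²` are
identified when their coordinates agree after continuation by zero. -/
def IsNormalFormOf {n : ℕ} (x : Fin 3 → Ball 2) (y : Fin 3 → Ball n) : Prop :=
  ClassN x ∧ ∃ Φ : Ball n ≃ Ball n, IsBallAut Φ ∧ ∀ j i, coord (Φ (y j)) i = coord (x j) i

/-! ## The Drury–Arveson space -/

/-- The kernel `k_w(z) = (1 - (z, w))⁻¹`, where `(z, w) = ∑ zᵢ conj wᵢ`, as an operator-valued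
kernel with entry `(z, w)` equal to multiplication by `k_w(z)`. -/
def kernelMatrix (n : ℕ) : Matrix (Ball n) (Ball n) (ℂ →L[ℂ] ℂ) :=
  Matrix.of fun z w =>
    (1 - inner ℂ (w : EuclideanSpace ℂ (Fin n)) (z : EuclideanSpace ℂ (Fin n)))⁻¹ •
      ContinuousLinearMap.id ℂ ℂ

theorem norm_inner_lt_one {n : ℕ} (z w : Ball n) :
    ‖inner ℂ (w : EuclideanSpace ℂ (Fin n)) (z : EuclideanSpace ℂ (Fin n))‖ < 1 := by
  have hz : ‖(z : EuclideanSpace ℂ (Fin n))‖ < 1 := mem_ball_zero_iff.1 z.2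
  have hw : ‖(w : EuclideanSpace ℂ (Fin n))‖ < 1 := mem_ball_zero_iff.1 w.2
  calc _ ≤ _ := norm_inner_le_norm _ _
    _ < 1 := mul_lt_one_of_nonneg_of_lt_one_left (norm_nonneg _) hw hz.le

theorem posSemidef_gram_pow {n : ℕ} {κ : Type*} [Fintype κ] (p : κ → Ball n) (m : ℕ) :
    (Matrix.of fun a b => (inner ℂ (p b : EuclideanSpace ℂ (Fin n))
      (p a : EuclideanSpace ℂ (Fin n))) ^ m : Matrix κ κ ℂ).PosSemidef := by
  classical
  induction m with
  | zero =>
    have h := Matrix.posSemidef_vecMulVec_self_star (fun _ : κ => (1 : ℂ))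
    convert h using 1
    ext a b
    simp [Matrix.vecMulVec]
  | succ m ih =>
    have h := (Matrix.posSemidef_gram ℂ
      (fun a : κ => (p a : EuclideanSpace ℂ (Fin n)))).transpose
    have e := ih.hadamard h
    refine Eq.subst (motive := Matrix.PosSemidef) ?_ e
    ext a b
    simp [pow_succ]

theorem kernelMatrix_posSemidef (n : ℕ) : (kernelMatrix n).PosSemidef := by
  have tf := (RKHS.posSemidef_tfae (K := kernelMatrix n)).out 0 2
  refine tf.mpr ⟨?_, fun v => ?_⟩
  · ext1 z w
    simp only [kernelMatrix, Matrix.conjTranspose_apply, Matrix.of_apply, star_smul, star_inv₀,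
      star_sub, star_one]
    congr 1
    · simp
    · exact ContinuousLinearMap.adjoint_id
  · have key : ∀ z w : Ball n, HasSum
        (fun m : ℕ => (starRingEnd ℂ (v z)) * (inner ℂ (w : EuclideanSpace ℂ (Fin n))
          (z : EuclideanSpace ℂ (Fin n))) ^ m * v w)
        (inner ℂ (kernelMatrix n w z (v z)) (v w)) := by
      intro z w
      have h := ((hasSum_geometric_of_norm_lt_one (norm_inner_lt_one z w)).mul_left
        (starRingEnd ℂ (v z))).mul_right (v w)
      have e : inner ℂ (kernelMatrix n w z (v z)) (v w) =
          (starRingEnd ℂ) (v z) * (1 - inner ℂ (w : EuclideanSpace ℂ (Fin n))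
            (z : EuclideanSpace ℂ (Fin n)))⁻¹ * v w := by
        simp [kernelMatrix]
        ring
      rw [e]
      exact h
    have tot : HasSum (fun m : ℕ => ∑ z ∈ v.support, ∑ w ∈ v.support,
        (starRingEnd ℂ (v z)) * (inner ℂ (w : EuclideanSpace ℂ (Fin n))
          (z : EuclideanSpace ℂ (Fin n))) ^ m * v w)
        (v.sum fun z a => v.sum fun w b => inner ℂ (kernelMatrix n w z a) b) :=
      hasSum_sum fun z _ => hasSum_sum fun w _ => key z w
    have hre := Complex.hasSum_re tot
    refine hre.nonneg fun m => ?_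
    have h := (posSemidef_gram_pow (fun a : v.support => (a : Ball n)) m).dotProduct_mulVec_nonneg
      (fun a => v a)
    have h2 := (Complex.nonneg_iff.1 h).1
    refine h2.trans_eq (congrArg Complex.re ?_)
    simp only [dotProduct, Matrix.mulVec, Finset.mul_sum, Pi.star_apply, Matrix.of_apply]
    rw [← Finset.sum_coe_sort v.support]
    refine Finset.sum_congr rfl fun a _ => ?_
    rw [← Finset.sum_coe_sort v.support]
    refine Finset.sum_congr rfl fun b _ => ?_
    simp [mul_assoc]

instance (n : ℕ) : Fact (kernelMatrix n).PosSemidef := ⟨kernelMatrix_posSemidef n⟩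

/-- The Drury–Arveson space `DA_n`: the reproducing kernel Hilbert space of functions on the
ball with kernel `k_w(z) = (1 - (z, w))⁻¹`. -/
abbrev DA (n : ℕ) : Type := RKHS.OfKernel (kernelMatrix n)

/-- The reproducing kernel function `k_w ∈ DA_n`. -/
def kerVec {n : ℕ} (w : Ball n) : DA n := RKHS.kerFun (DA n) w 1

theorem kerVec_apply {n : ℕ} (w z : Ball n) :
    kerVec w z = (1 - inner ℂ (w : EuclideanSpace ℂ (Fin n)) (z : EuclideanSpace ℂ (Fin n)))⁻¹ := by
  rw [kerVec, RKHS.kerFun_apply, RKHS.OfKernel.kernel_ofKernel]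
  simp [kernelMatrix]

/-- For a family `X = {x_i}` in the ball, `DA_n(X)` is the span of the kernel functions
`k_{x_i}` in `DA_n`, with the norm of `DA_n`. Its elements are regarded as functions on `X`. -/
def DASub {ι : Type*} {n : ℕ} (x : ι → Ball n) : Submodule ℂ (DA n) :=
  Submodule.span ℂ (Set.range fun i => kerVec (x i))

section Invariants

variable {ι : Type*} {n : ℕ} (x : ι → Ball n)

/-- The Gram matrix entry `k_ij = ⟨k_i, k_j⟩ = k_{x_i}(x_j)`. The inner product of Mathlib is
linear in its second argument. -/
def gram (i j : ι) : ℂ := inner ℂ (kerVec (x j)) (kerVec (x i))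

/-- The metric `δ_ij = (1 - |k_ij|² / (k_ii k_jj))^{1/2}`. -/
def delta (i j : ι) : ℝ :=
  Real.sqrt (1 - ‖gram x i j‖ ^ 2 / ((gram x i i).re * (gram x j j).re))

/-- `LF_ijl² = δ_ij⁻² |1 - k_ji k_il / (k_jl k_ii)|²`. -/
def LFsq (i j l : ι) : ℝ :=
  1 / delta x i j ^ 2 *
    ‖1 - gram x j i * gram x i l / (gram x j l * gram x i i)‖ ^ 2

/-- A multiplier of `DA_n(X)`: a symbol function `m` on `X` with its multiplier operator `M_m`,
`(M_m h)(x) = m(x) h(x)`. -/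
@[ext]
structure Multiplier where
  /-- The symbol function. -/
  symbol : ι → ℂ
  /-- The multiplier operator. -/
  op : DASub x →L[ℂ] DASub x
  op_apply : ∀ (h : DASub x) (i : ι), (op h : DA n) (x i) = symbol i * (h : DA n) (x i)

variable {x}

/-- The norm of the multiplier algebra is the operator norm. -/
instance : Norm (Multiplier x) := ⟨fun m => ‖m.op‖⟩

instance : Mul (Multiplier x) :=
  ⟨fun m m' => ⟨fun i => m.symbol i * m'.symbol i, m.op ∘L m'.op, fun h i => by
    simp [m.op_apply, m'.op_apply, mul_assoc]⟩⟩

instance : SMul ℂ (Multiplier x) :=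
  ⟨fun c m => ⟨fun i => c * m.symbol i, c • m.op, fun h i => by
    simp [m.op_apply, mul_assoc]⟩⟩

/-- `m` is a multiplier of norm one that vanishes at the points with index in `Z` and that
maximizes `Re m(x_a)` among all such multipliers. -/
def IsExtremal (Z : Set ι) (a : ι) (m : Multiplier x) : Prop :=
  (‖m‖ = 1 ∧ ∀ z ∈ Z, m.symbol z = 0) ∧
    ∀ m' : Multiplier x, (‖m'‖ = 1 ∧ ∀ z ∈ Z, m'.symbol z = 0) →
      (m'.symbol a).re ≤ (m.symbol a).re

variable (x)

/-- `Δ_G(x_a; x_b, x_c)`, the extremal value for the multiplier algebra. -/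
def DeltaG (a b c : ι) : ℝ :=
  sSup {r | ∃ m : Multiplier x, m.symbol b = 0 ∧ m.symbol c = 0 ∧ ‖m‖ ≤ 1 ∧
    r = (m.symbol a).re}

/-- `Δ_H(x_a; x_b, x_c)`, the extremal value for the Hilbert space `H = DA_n(X)`. -/
def DeltaH (a b c : ι) : ℝ :=
  1 / ‖kerVec (x a)‖ *
    sSup {r | ∃ h : DASub x, (h : DA n) (x b) = 0 ∧ (h : DA n) (x c) = 0 ∧ ‖h‖ ≤ 1 ∧
      r = ((h : DA n) (x a)).re}

end Invariants

end DruryArveson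

end

open DruryArveson

noncomputable section

open scoped ComplexOrder

namespace DruryArveson

/-! Each of the eight conditions says that the coordinate `t` of the normal form vanishes. Points
are numbered from 0, so `x 0` is the centre; write r = ‖x 2‖, so that r² = |w|² + t².

A Möbius involution moves `y 0` to the centre. By Cartan's theorem (`IsBallAut.inner_apply`) the
freedom that remains preserves inner products, so the inner products of the moved points are
invariants of `y`. They determine s, w and t (`HasNormalCoords.eq_of_inner_eq`), and for points of
one complex geodesic their matrix has rank one, which forces t = 0.

The conditions on multipliers rest on the complete Pick identity `inner_rejection_kerVec`. It turns
contractivity of a multiplier vanishing at one point into positivity of a 2×2 Hermitian form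
(`Multiplier.norm_le_one_iff`). For an extremal multiplier a diagonal entry of the form is zero,
hence so is the off-diagonal entry, which fixes the third value. With values listed at `x 0`, `x 1`,
`x 2`, this gives M₂ = (0, s, w) and M₃ = (0, s w̄/r, r), which agree up to a phase iff |w| = r. It
also gives m₂m₃ = (s r, 0, 0).

Multipliers supported at `x 0` are rank-one operators, with norm |m(x 0)| ‖k₀‖ ‖g‖, where g is 1 at
`x 0` and 0 at the other points. As ‖k₀‖ = 1, the value m₂₃(x 0), Δ_G and Δ_H all equal 1/‖g‖, and
the last four conditions become s r ‖g‖ = 1. Cramer's rule computes ‖g‖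
(`HasNormalCoords.norm_sq_mul_eq`), and strict Cauchy–Schwarz for the kernels reduces the equation
to t = 0. -/

theorem IsHolomorphicMap.comp {n : ℕ} {f g : Ball n → Ball n} (hf : IsHolomorphicMap f)
    (hg : IsHolomorphicMap g) : IsHolomorphicMap (f ∘ g) := by
  obtain ⟨F, hF, hFf⟩ := hf
  obtain ⟨G, hG, hGg⟩ := hg
  refine ⟨F ∘ G, hF.comp hG fun z hz => ?_, fun z => ?_⟩
  · rw [hGg ⟨z, hz⟩]
    exact (g ⟨z, hz⟩).2
  · simp [hGg, hFf]

theorem IsBallAut.trans {n : ℕ} {Φ Ψ : Ball n ≃ Ball n} (hΦ : IsBallAut Φ) (hΨ : IsBallAut Ψ) :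
    IsBallAut (Φ.trans Ψ) :=
  ⟨hΨ.1.comp hΦ.1, hΦ.2.comp hΨ.2⟩

theorem IsBallAut.symm {n : ℕ} {Φ : Ball n ≃ Ball n} (hΦ : IsBallAut Φ) : IsBallAut Φ.symm :=
  ⟨hΦ.2, hΦ.1⟩

/-! ### Möbius involutions of the ball -/

section Moebius

variable {E : Type*} [NormedAddCommGroup E] [InnerProductSpace ℂ E]

/-- The involutive Möbius map of the unit ball exchanging `a` and `0`. -/
def moebius (a z : E) : E :=
  (1 - inner ℂ a z)⁻¹ •
    ((1 - inner ℂ a z / (1 + Real.sqrt (1 - ‖a‖ ^ 2))) • a - (Real.sqrt (1 - ‖a‖ ^ 2) : ℂ) • z)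

theorem inner_self_eq_ofReal (z : E) : inner ℂ z z = ((‖z‖ ^ 2 : ℝ) : ℂ) := by
  rw [inner_self_eq_norm_sq_to_K]
  simp

theorem one_sub_inner_ne_zero {z w : E} (hz : ‖z‖ < 1) (hw : ‖w‖ < 1) : 1 - inner ℂ z w ≠ 0 := by
  intro h
  have h1 : inner ℂ z w = 1 := (sub_eq_zero.1 h).symm
  have h2 := norm_inner_le_norm (𝕜 := ℂ) z w
  rw [h1, norm_one] at h2
  nlinarith [norm_nonneg z, norm_nonneg w]

theorem one_add_sqrt_ne_zero (x : ℝ) : (1 + (Real.sqrt x : ℂ)) ≠ 0 := by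
  have : (0 : ℝ) < 1 + Real.sqrt x := by positivity
  exact_mod_cast this.ne'

/-- With ρ = √(1 - ‖a‖²) this reads ‖a‖² = (1 - ρ)(1 + ρ). It explains the form of `moebius`: the
projection onto a would divide by ‖a‖², but (1 - ρ)/‖a‖² = 1/(1 + ρ), so a = 0 needs no separate
case. -/
theorem sqrt_one_sub_sq {a : E} (ha : ‖a‖ < 1) :
    inner ℂ a a = 1 - (Real.sqrt (1 - ‖a‖ ^ 2) : ℂ) ^ 2 := by
  have h : Real.sqrt (1 - ‖a‖ ^ 2) ^ 2 = 1 - ‖a‖ ^ 2 :=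
    Real.sq_sqrt (by nlinarith [norm_nonneg a])
  rw [← Complex.ofReal_pow, h, inner_self_eq_ofReal]
  simp

/-- For z = w the right side is positive, so the ball is preserved. For general z and w this is the
source of the Pick identity for the kernel 1/(1 - ⟨z, w⟩). -/
theorem one_sub_inner_moebius {a z w : E} (ha : ‖a‖ < 1) (hz : ‖z‖ < 1) (hw : ‖w‖ < 1) :
    1 - inner ℂ (moebius a w) (moebius a z) =
      (1 - inner ℂ a a) * (1 - inner ℂ w z) / ((1 - inner ℂ w a) * (1 - inner ℂ a z)) := by
  have h1 := one_sub_inner_ne_zero ha hz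
  have h2 := one_sub_inner_ne_zero hw ha
  have he := one_add_sqrt_ne_zero (1 - ‖a‖ ^ 2)
  have hA := sqrt_one_sub_sq ha
  simp only [moebius, inner_smul_left, inner_smul_right, inner_sub_left, inner_sub_right, map_inv₀,
    map_sub, map_one, map_div₀, map_add, Complex.conj_ofReal, inner_conj_symm]
  rw [hA]
  generalize (Real.sqrt (1 - ‖a‖ ^ 2) : ℂ) = ρ at *
  field_simp
  ring

theorem norm_moebius_lt_one {a z : E} (ha : ‖a‖ < 1) (hz : ‖z‖ < 1) : ‖moebius a z‖ < 1 := by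
  have h := one_sub_inner_moebius ha hz hz
  have h1 := one_sub_inner_ne_zero ha hz
  have e : (1 - inner ℂ z a) * (1 - inner ℂ a z) = ((‖1 - inner ℂ a z‖ ^ 2 : ℝ) : ℂ) := by
    rw [← Complex.normSq_eq_norm_sq, Complex.normSq_eq_conj_mul_self]
    simp
  rw [e, inner_self_eq_ofReal, inner_self_eq_ofReal, inner_self_eq_ofReal] at h
  have h' : 1 - ‖moebius a z‖ ^ 2 = (1 - ‖a‖ ^ 2) * (1 - ‖z‖ ^ 2) / ‖1 - inner ℂ a z‖ ^ 2 := by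
    exact_mod_cast h
  have h3 : 0 < (1 - ‖a‖ ^ 2) * (1 - ‖z‖ ^ 2) / ‖1 - inner ℂ a z‖ ^ 2 := by
    have : 0 < 1 - ‖a‖ ^ 2 := by nlinarith [norm_nonneg a]
    have : 0 < 1 - ‖z‖ ^ 2 := by nlinarith [norm_nonneg z]
    positivity
  nlinarith [norm_nonneg (moebius a z)]

theorem moebius_moebius {a z : E} (ha : ‖a‖ < 1) (hz : ‖z‖ < 1) :
    moebius a (moebius a z) = z := by
  have h1 := one_sub_inner_ne_zero ha hz
  have h2 := one_sub_inner_ne_zero ha ha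
  have he := one_add_sqrt_ne_zero (1 - ‖a‖ ^ 2)
  have hA := sqrt_one_sub_sq ha
  have hi : inner ℂ a (moebius a z) = (inner ℂ a a - inner ℂ a z) / (1 - inner ℂ a z) := by
    simp only [moebius, inner_smul_right, inner_sub_right]
    rw [hA]
    field_simp
    ring
  have hi' : 1 - inner ℂ a (moebius a z) = (1 - inner ℂ a a) / (1 - inner ℂ a z) := by
    rw [hi]
    field_simp
    ring
  rw [moebius, hi', hi]
  unfold moebius
  rw [hA] at h2 ⊢
  generalize (Real.sqrt (1 - ‖a‖ ^ 2) : ℂ) = ρ at *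
  -- The inner factor contributes 1 - ⟨a, a⟩ = ρ², which has to be cancelled.
  have h3 : ρ ≠ 0 := by
    rintro rfl
    simp at h2
  match_scalars
  · field_simp
    ring
  · field_simp
    ring

theorem moebius_self {a : E} (ha : ‖a‖ < 1) : moebius a a = 0 := by
  have h2 := one_sub_inner_ne_zero ha ha
  have he := one_add_sqrt_ne_zero (1 - ‖a‖ ^ 2)
  have hA := sqrt_one_sub_sq ha
  rw [moebius, ← sub_smul, smul_eq_zero, smul_eq_zero]
  refine Or.inr (Or.inl ?_)
  rw [hA]
  field_simp
  ring

theorem differentiableOn_moebius {a : E} (ha : ‖a‖ < 1) :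
    DifferentiableOn ℂ (moebius a) (Metric.ball 0 1) := by
  have hd : Differentiable ℂ fun z : E => inner ℂ a z := (innerSL ℂ a).differentiable
  intro z hz
  have h1 := one_sub_inner_ne_zero ha (mem_ball_zero_iff.1 hz)
  refine DifferentiableAt.differentiableWithinAt ?_
  have hz := hd z
  unfold moebius
  exact ((((differentiableAt_const _).sub hz).inv h1).smul
    ((((differentiableAt_const _).sub (DifferentiableAt.mul_const hz _)).smul_const a).sub
      (differentiableAt_id.const_smul _)))

end Moebius

/-! ### Automorphisms of the ball and Cartan's theorem -/

theorem Ball.norm_lt {n : ℕ} (z : Ball n) : ‖(z : EuclideanSpace ℂ (Fin n))‖ < 1 :=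
  mem_ball_zero_iff.1 z.2

/-- The Möbius map as a self-map of the ball. -/
def moebiusEquiv {n : ℕ} (a : Ball n) : Ball n ≃ Ball n where
  toFun z := ⟨moebius a.1 z.1, mem_ball_zero_iff.2 (norm_moebius_lt_one a.norm_lt z.norm_lt)⟩
  invFun z := ⟨moebius a.1 z.1, mem_ball_zero_iff.2 (norm_moebius_lt_one a.norm_lt z.norm_lt)⟩
  left_inv z := Subtype.ext (moebius_moebius a.norm_lt z.norm_lt)
  right_inv z := Subtype.ext (moebius_moebius a.norm_lt z.norm_lt)

theorem isBallAut_moebiusEquiv {n : ℕ} (a : Ball n) : IsBallAut (moebiusEquiv a) :=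
  ⟨⟨moebius a.1, differentiableOn_moebius a.norm_lt, fun _ => rfl⟩,
    ⟨moebius a.1, differentiableOn_moebius a.norm_lt, fun _ => rfl⟩⟩

/-- The self-map of the ball induced by a unitary map. -/
def unitaryEquiv {n : ℕ} (U : EuclideanSpace ℂ (Fin n) ≃ₗᵢ[ℂ] EuclideanSpace ℂ (Fin n)) :
    Ball n ≃ Ball n where
  toFun z := ⟨U z.1, mem_ball_zero_iff.2 (by simpa using z.norm_lt)⟩
  invFun z := ⟨U.symm z.1, mem_ball_zero_iff.2 (by simpa using z.norm_lt)⟩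
  left_inv z := Subtype.ext (by simp)
  right_inv z := Subtype.ext (by simp)

theorem isBallAut_unitaryEquiv {n : ℕ}
    (U : EuclideanSpace ℂ (Fin n) ≃ₗᵢ[ℂ] EuclideanSpace ℂ (Fin n)) :
    IsBallAut (unitaryEquiv U) :=
  ⟨⟨U, U.toContinuousLinearEquiv.differentiable.differentiableOn, fun _ => rfl⟩,
    ⟨U.symm, U.symm.toContinuousLinearEquiv.differentiable.differentiableOn, fun _ => rfl⟩⟩

/-- The centre of the ball. -/
def Ball.zero (n : ℕ) : Ball n := ⟨0, by simp⟩

theorem moebiusEquiv_self {n : ℕ} (a : Ball n) : moebiusEquiv a a = Ball.zero n :=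
  Subtype.ext (moebius_self a.norm_lt)

theorem IsHolomorphicMap.norm_apply_le {n : ℕ} {f : Ball n → Ball n} (hf : IsHolomorphicMap f)
    (h0 : f (Ball.zero n) = Ball.zero n) (z : Ball n) : ‖(f z).1‖ ≤ ‖z.1‖ := by
  obtain ⟨F, hF, hFf⟩ := hf
  rw [← hFf]
  refine Complex.norm_le_norm_of_mapsTo_ball (R := 1) hF (fun w hw => ?_) ?_ z.norm_lt
  · rw [hFf ⟨w, hw⟩]
    exact Metric.ball_subset_closedBall (f ⟨w, hw⟩).2
  · have := hFf (Ball.zero n)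
    rw [h0] at this
    exact this

/-- The Schwarz lemma, applied to the map and to its inverse. -/
theorem IsBallAut.norm_apply {n : ℕ} {Φ : Ball n ≃ Ball n} (hΦ : IsBallAut Φ)
    (h0 : Φ (Ball.zero n) = Ball.zero n) (z : Ball n) : ‖(Φ z).1‖ = ‖z.1‖ := by
  refine (hΦ.1.norm_apply_le h0 z).antisymm ?_
  have := hΦ.2.norm_apply_le (Φ.symm_apply_eq.2 h0.symm) (Φ z)
  simpa using this

/-- Cartan's theorem: an automorphism of the ball that fixes the centre is linear, hence
unitary. -/
theorem IsBallAut.inner_apply {n : ℕ} {Φ : Ball n ≃ Ball n} (hΦ : IsBallAut Φ)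
    (h0 : Φ (Ball.zero n) = Ball.zero n) (z w : Ball n) :
    inner ℂ (Φ z).1 (Φ w).1 = inner ℂ z.1 w.1 := by
  obtain ⟨F, hF, hFΦ⟩ := hΦ.1
  have hF0 : F 0 = 0 := by
    have := hFΦ (Ball.zero n)
    rw [h0] at this
    exact this
  have hnorm : ∀ v : EuclideanSpace ℂ (Fin n), ‖v‖ < 1 → ‖F v‖ = ‖v‖ := fun v hv => by
    rw [hFΦ ⟨v, mem_ball_zero_iff.2 hv⟩]
    exact hΦ.norm_apply h0 ⟨v, _⟩
  have hdiff : DifferentiableAt ℂ F 0 := hF.differentiableAt (Metric.ball_mem_nhds _ one_pos)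
  have hray : ∀ u : EuclideanSpace ℂ (Fin n), ‖u‖ = 1 → ∀ c : ℂ, ‖c‖ < 1 →
      F (c • u) = c • fderiv ℂ F 0 u := by
    intro u hu
    set f : ℂ → EuclideanSpace ℂ (Fin n) := fun c => F (c • u) with hf
    have hf0 : f 0 = 0 := by simp [hf, hF0]
    have hmem : ∀ c ∈ Metric.ball (0 : ℂ) 1, ‖c • u‖ < 1 := fun c hc => by
      rw [norm_smul, hu, mul_one]
      exact mem_ball_zero_iff.1 hc
    have hfd : DifferentiableOn ℂ f (Metric.ball 0 1) :=
      hF.comp (differentiable_id.smul_const u).differentiableOn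
        fun c hc => mem_ball_zero_iff.2 (hmem c hc)
    have hmaps : Set.MapsTo f (Metric.ball 0 1) (Metric.closedBall (f 0) 1) := fun c hc => by
      rw [hf0, mem_closedBall_zero_iff, hf]
      exact (hnorm _ (hmem c hc)).le.trans (hmem c hc).le
    have hhalf : ((1 / 2 : ℝ) : ℂ) ∈ Metric.ball (0 : ℂ) 1 := by
      rw [mem_ball_zero_iff, Complex.norm_real]
      norm_num
    -- Norms are preserved, so the difference quotient at 1/2 has norm exactly 1. This is equality
    -- in the Schwarz lemma, which makes f affine along the whole disc.
    have haff := Complex.affine_of_mapsTo_ball_of_norm_dslope_eq_div hfd hmaps hhalf (by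
      rw [dslope_of_ne _ (by norm_num), slope_def_module, hf0, norm_smul, hf, sub_zero, sub_zero,
        hnorm _ (hmem _ hhalf), norm_smul, hu, norm_inv, Complex.norm_real]
      norm_num)
    have hder : HasDerivAt f (fderiv ℂ F 0 u) 0 := by
      have h1 : HasDerivAt (fun c : ℂ => c • u) u 0 := by
        simpa using (hasDerivAt_id (0 : ℂ)).smul_const u
      have h2 : HasFDerivAt F (fderiv ℂ F 0) ((0 : ℂ) • u) := by
        rw [zero_smul]
        exact hdiff.hasFDerivAt
      exact h2.comp_hasDerivAt 0 h1
    intro c hc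
    have hC : fderiv ℂ F 0 u = dslope f 0 ((1 / 2 : ℝ) : ℂ) := by
      refine hder.unique ?_
      have h1 : HasDerivAt (fun c : ℂ => f 0 + (c - 0) • dslope f 0 ((1 / 2 : ℝ) : ℂ))
          (dslope f 0 ((1 / 2 : ℝ) : ℂ)) 0 := by
        simpa using (((hasDerivAt_id (0 : ℂ)).sub_const 0).smul_const
          (dslope f 0 ((1 / 2 : ℝ) : ℂ))).const_add (f 0)
      refine h1.congr_of_eventuallyEq ?_
      filter_upwards [Metric.ball_mem_nhds (0 : ℂ) one_pos] with c hc
      exact haff hc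
    have := haff (mem_ball_zero_iff.2 hc)
    rw [hC]
    simpa [hf0] using this
  have hlin : ∀ v : Ball n, (Φ v).1 = fderiv ℂ F 0 v.1 := by
    intro v
    rw [← hFΦ]
    rcases eq_or_ne v.1 0 with hv | hv
    · simp [hv, hF0]
    · have hv' : (‖v.1‖ : ℂ) ≠ 0 := by exact_mod_cast norm_ne_zero_iff.2 hv
      have := hray ((‖v.1‖ : ℂ)⁻¹ • v.1) (by
        rw [norm_smul, norm_inv, Complex.norm_real, norm_norm,
          inv_mul_cancel₀ (norm_ne_zero_iff.2 hv)]) (‖v.1‖ : ℂ) (by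
        rw [Complex.norm_real, norm_norm]; exact v.norm_lt)
      rw [map_smul, smul_inv_smul₀ hv', smul_inv_smul₀ hv'] at this
      exact this
  have hiso : ∀ v : EuclideanSpace ℂ (Fin n), ‖fderiv ℂ F 0 v‖ = ‖v‖ := by
    intro v
    -- Dividing by 1 + ‖v‖ brings any vector into the ball, where norms are known to be preserved.
    have hpos : 0 < 1 + ‖v‖ := by positivity
    have hc : ((1 + ‖v‖ : ℝ) : ℂ) ≠ 0 := by exact_mod_cast hpos.ne'
    have hn : ‖((1 + ‖v‖ : ℝ) : ℂ)⁻¹‖ = (1 + ‖v‖)⁻¹ := by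
      rw [norm_inv, Complex.norm_real, Real.norm_of_nonneg hpos.le]
    have hmem : ‖((1 + ‖v‖ : ℝ) : ℂ)⁻¹ • v‖ < 1 := by
      rw [norm_smul, hn, ← div_eq_inv_mul, div_lt_one hpos]
      linarith
    have h := hΦ.norm_apply h0 ⟨_, mem_ball_zero_iff.2 hmem⟩
    rw [hlin, map_smul, norm_smul, norm_smul, hn] at h
    exact mul_left_cancel₀ (inv_ne_zero hpos.ne') h
  rw [hlin, hlin]
  exact LinearIsometry.inner_map_map (⟨(fderiv ℂ F 0).toLinearMap, hiso⟩ :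
    EuclideanSpace ℂ (Fin n) →ₗᵢ[ℂ] EuclideanSpace ℂ (Fin n)) z.1 w.1

/-! ### Coordinates and existence of the normal form -/

theorem inner_eq_sum_coord {n : ℕ} (z w : Ball n) {N : ℕ} (hN : n ≤ N) :
    inner ℂ z.1 w.1 = ∑ i ∈ Finset.range N, coord w i * starRingEnd ℂ (coord z i) := by
  have h1 : ∑ i ∈ Finset.range n, coord w i * starRingEnd ℂ (coord z i) =
      ∑ i ∈ Finset.range N, coord w i * starRingEnd ℂ (coord z i) := by
    refine Finset.sum_subset (Finset.range_mono hN) fun i _ hi => ?_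
    have : ¬ i < n := by simpa using hi
    simp [coord, this]
  rw [← h1, ← Fin.sum_univ_eq_sum_range (fun i => coord w i * starRingEnd ℂ (coord z i)),
    PiLp.inner_apply]
  simp [coord]

theorem inner_eq_of_coord_eq {n m : ℕ} {z z' : Ball n} {w w' : Ball m}
    (h : ∀ i, coord z i = coord w i) (h' : ∀ i, coord z' i = coord w' i) :
    inner ℂ z.1 z'.1 = inner ℂ w.1 w'.1 := by
  rw [inner_eq_sum_coord z z' (le_max_left n m), inner_eq_sum_coord w w' (le_max_right n m)]
  simp [h, h']

theorem Ball.ext_coord {n : ℕ} {z w : Ball n} (h : ∀ i, coord z i = coord w i) : z = w := by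
  refine Subtype.ext (PiLp.ext fun i => ?_)
  simpa [coord] using h i

theorem coord_zero {n : ℕ} (i : ℕ) : coord (Ball.zero n) i = 0 := by
  simp [coord, Ball.zero]

/-- A point of the ball with at most two nonzero coordinates, regarded as a point of `𝔹²`. -/
theorem exists_ball_two {n : ℕ} (z : Ball n) (hz : ∀ i, 2 ≤ i → coord z i = 0) :
    ∃ x : Ball 2, x.1 = !₂[coord z 0, coord z 1] ∧ ∀ i, coord z i = coord x i := by
  have hn : ‖(!₂[coord z 0, coord z 1] : EuclideanSpace ℂ (Fin 2))‖ < 1 := by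
    have h1 : ‖z.1‖ ^ 2 = ‖coord z 0‖ ^ 2 + ‖coord z 1‖ ^ 2 := by
      have h2 := inner_eq_sum_coord z z (Nat.le_add_right n 2)
      rw [← Finset.sum_subset (Finset.range_mono (Nat.le_add_left 2 n))
        (fun i _ hi => by rw [hz i (not_lt.1 (by simpa using hi))]; simp), Finset.sum_range_succ,
        Finset.sum_range_one, Complex.mul_conj, Complex.mul_conj, Complex.normSq_eq_norm_sq,
        Complex.normSq_eq_norm_sq, inner_self_eq_ofReal] at h2
      exact_mod_cast h2
    have h3 := z.norm_lt
    rw [EuclideanSpace.norm_eq, Fin.sum_univ_two, Real.sqrt_lt' one_pos]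
    simp only [Matrix.cons_val_zero, Matrix.cons_val_one]
    rw [← h1]
    nlinarith [norm_nonneg z.1]
  refine ⟨⟨_, mem_ball_zero_iff.2 hn⟩, rfl, fun i => ?_⟩
  match i with
  | 0 => simp [coord]
  | 1 => simp [coord]
  | (k + 2) =>
    rw [hz _ (by omega)]
    simp [coord]

/-- Multiplication by a complex number of modulus one as a linear isometry. -/
def phaseEquiv (c : ℂ) (hc : ‖c‖ = 1) : ℂ ≃ₗᵢ[ℂ] ℂ where
  toLinearEquiv := LinearEquiv.smulOfUnit (Units.mk0 c (norm_ne_zero_iff.1 (by simp [hc])))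
  norm_map' z := by
    change ‖c * z‖ = ‖z‖
    rw [norm_mul, hc, one_mul]

theorem exists_phase (z : ℂ) : ∃ c : ℂ, ‖c‖ = 1 ∧ c * z = ‖z‖ := by
  rcases eq_or_ne z 0 with rfl | hz
  · exact ⟨1, by simp⟩
  · have h : (‖z‖ : ℂ) ≠ 0 := by exact_mod_cast norm_ne_zero_iff.2 hz
    refine ⟨‖z‖ / z, ?_, div_mul_cancel₀ _ hz⟩
    rw [norm_div, Complex.norm_real, norm_norm, div_self (norm_ne_zero_iff.2 hz)]

/-- Gram–Schmidt on u, v gives triangular coordinates, and a diagonal unitary then makes the two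
diagonal entries nonnegative. Dimensions below 2 are covered because `coord` continues by zero. -/
theorem exists_unitary_triangular {n : ℕ} (u v : Ball n) :
    ∃ U : EuclideanSpace ℂ (Fin n) ≃ₗᵢ[ℂ] EuclideanSpace ℂ (Fin n),
      (∃ s : ℝ, 0 ≤ s ∧ coord (unitaryEquiv U u) 0 = s) ∧
      (∃ t : ℝ, 0 ≤ t ∧ coord (unitaryEquiv U v) 1 = t) ∧
      (∀ i, 1 ≤ i → coord (unitaryEquiv U u) i = 0) ∧
      ∀ i, 2 ≤ i → coord (unitaryEquiv U v) i = 0 := by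
  let f : Fin n → EuclideanSpace ℂ (Fin n) := fun i =>
    if (i : ℕ) = 0 then u.1 else if (i : ℕ) = 1 then v.1 else 0
  let b := InnerProductSpace.gramSchmidtOrthonormalBasis (𝕜 := ℂ) (h := by simp) f
  have hu : ∀ i : Fin n, 1 ≤ (i : ℕ) → b.repr u.1 i = 0 := by
    intro i hi
    have h := InnerProductSpace.gramSchmidtOrthonormalBasis_inv_triangular' (𝕜 := ℂ)
      (h := by simp) f (i := ⟨0, by omega⟩) (j := i) (Fin.lt_def.2 hi)
    simpa [f] using h
  have hv : ∀ i : Fin n, 2 ≤ (i : ℕ) → b.repr v.1 i = 0 := by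
    intro i hi
    have h := InnerProductSpace.gramSchmidtOrthonormalBasis_inv_triangular' (𝕜 := ℂ)
      (h := by simp) f (i := ⟨1, by omega⟩) (j := i) (Fin.lt_def.2 hi)
    simpa [f] using h
  -- Only the phases at 0 (adapted to u) and at 1 (adapted to v) matter; the others are arbitrary.
  choose c hc1 hc using fun i : Fin n => exists_phase (if (i : ℕ) = 0 then b.repr u.1 i
    else b.repr v.1 i)
  let U := b.repr.trans (LinearIsometryEquiv.piLpCongrRight 2 fun i => phaseEquiv (c i) (hc1 i))
  have hU : ∀ (w : Ball n) (i : ℕ) (hi : i < n),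
      coord (unitaryEquiv U w) i = c ⟨i, hi⟩ * b.repr w.1 ⟨i, hi⟩ := by
    intro w i hi
    simp only [coord, hi, dif_pos]
    rfl
  have hU' : ∀ (w : Ball n) (i : ℕ), ¬ i < n → coord (unitaryEquiv U w) i = 0 :=
    fun w i hi => by simp [coord, hi]
  refine ⟨U, ?_, ?_, fun i hi => ?_, fun i hi => ?_⟩
  · by_cases h : 0 < n
    · exact ⟨_, norm_nonneg _, (hU u 0 h).trans (by simpa using hc ⟨0, h⟩)⟩
    · exact ⟨0, le_rfl, (hU' _ _ h).trans (by simp)⟩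
  · by_cases h : 1 < n
    · exact ⟨_, norm_nonneg _, (hU v 1 h).trans (by simpa using hc ⟨1, h⟩)⟩
    · exact ⟨0, le_rfl, (hU' _ _ h).trans (by simp)⟩
  · by_cases h : i < n
    · rw [hU u i h, hu ⟨i, h⟩ hi, mul_zero]
    · exact hU' _ _ h
  · by_cases h : i < n
    · rw [hU v i h, hv ⟨i, h⟩ hi, mul_zero]
    · exact hU' _ _ h

theorem exists_isNormalFormOf {n : ℕ} (y : Fin 3 → Ball n) (hy : Function.Injective y) :
    ∃ x, IsNormalFormOf x y := by
  obtain ⟨U, ⟨s, hs, hus⟩, ⟨t, ht, hvt⟩, hu, hv⟩ :=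
    exists_unitary_triangular (moebiusEquiv (y 0) (y 1)) (moebiusEquiv (y 0) (y 2))
  set Φ := (moebiusEquiv (y 0)).trans (unitaryEquiv U) with hΦ
  have hΦa : IsBallAut Φ := (isBallAut_moebiusEquiv _).trans (isBallAut_unitaryEquiv U)
  have h0 : Φ (y 0) = Ball.zero n := by
    simp only [hΦ, Equiv.trans_apply, moebiusEquiv_self]
    exact Subtype.ext (map_zero U)
  change coord (Φ (y 1)) 0 = s at hus
  change coord (Φ (y 2)) 1 = t at hvt
  change ∀ i, 1 ≤ i → coord (Φ (y 1)) i = 0 at hu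
  change ∀ i, 2 ≤ i → coord (Φ (y 2)) i = 0 at hv
  have hc0 : ∀ i, coord (Φ (y 0)) i = 0 := fun i => by rw [h0, coord_zero]
  -- If s = 0, the second point would also go to the centre, against injectivity.
  have hs' : s ≠ 0 := by
    rintro rfl
    have : Φ (y 1) = Φ (y 0) := Ball.ext_coord fun i => by
      rw [hc0]
      rcases Nat.eq_zero_or_pos i with rfl | hi
      · simpa using hus
      · exact hu i hi
    exact absurd (hy (Φ.injective this)) (by decide)
  have hx : ∀ j : Fin 3, ∃ x : Ball 2, x.1 = !₂[coord (Φ (y j)) 0, coord (Φ (y j)) 1] ∧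
      ∀ i, coord (Φ (y j)) i = coord x i := by
    intro j
    refine exists_ball_two _ fun i hi => ?_
    fin_cases j
    · exact hc0 i
    · exact hu i (by omega)
    · exact hv i hi
  choose x hx1 hx2 using hx
  refine ⟨x, ⟨s, t, coord (Φ (y 2)) 0, lt_of_le_of_ne hs hs'.symm, ht, ?_, ?_, ?_⟩,
    Φ, hΦa, hx2⟩
  · rw [hx1, hc0, hc0]
  · rw [hx1, hus, hu 1 le_rfl]
  · rw [hx1, hvt]

/-! ### Uniqueness of the normal form and complex geodesics -/

section NormalCoords

variable {x : Fin 3 → Ball 2} {s t : ℝ} {w : ℂ}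

theorem HasNormalCoords.inner_zero_left (h : HasNormalCoords x s t w) (j : Fin 3) :
    inner ℂ (x 0).1 (x j).1 = 0 := by
  rw [h.1]
  simp [PiLp.inner_apply]

theorem HasNormalCoords.inner_zero_right (h : HasNormalCoords x s t w) (j : Fin 3) :
    inner ℂ (x j).1 (x 0).1 = 0 := by
  rw [h.1]
  simp [PiLp.inner_apply]

theorem HasNormalCoords.inner_one_one (h : HasNormalCoords x s t w) :
    inner ℂ (x 1).1 (x 1).1 = (s : ℂ) ^ 2 := by
  rw [h.2.1, PiLp.inner_apply, Fin.sum_univ_two]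
  simp [sq, ← Complex.ofReal_mul]

theorem HasNormalCoords.inner_one_two (h : HasNormalCoords x s t w) :
    inner ℂ (x 1).1 (x 2).1 = s * w := by
  rw [h.2.1, h.2.2]
  simp [PiLp.inner_apply, mul_comm]

theorem HasNormalCoords.inner_two_one (h : HasNormalCoords x s t w) :
    inner ℂ (x 2).1 (x 1).1 = s * starRingEnd ℂ w := by
  rw [h.2.1, h.2.2]
  simp [PiLp.inner_apply]

theorem HasNormalCoords.inner_two_two (h : HasNormalCoords x s t w) :
    inner ℂ (x 2).1 (x 2).1 = ((‖w‖ ^ 2 + t ^ 2 : ℝ) : ℂ) := by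
  rw [h.2.2, PiLp.inner_apply, Fin.sum_univ_two]
  simp [sq, ← Complex.ofReal_mul]

/-- The products ⟨x 1, x 1⟩, ⟨x 1, x 2⟩ and ⟨x 2, x 2⟩ give s², s w and |w|² + t². The signs of s
and t select the square roots. -/
theorem HasNormalCoords.eq_of_inner_eq {x' : Fin 3 → Ball 2} {s' t' : ℝ} {w' : ℂ} (hs : 0 < s)
    (hs' : 0 < s') (ht : 0 ≤ t) (ht' : 0 ≤ t') (h : HasNormalCoords x s t w)
    (h' : HasNormalCoords x' s' t' w')
    (hi : ∀ i j, inner ℂ (x i).1 (x j).1 = inner ℂ (x' i).1 (x' j).1) : x = x' := by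
  have h11 := hi 1 1
  rw [h.inner_one_one, h'.inner_one_one] at h11
  have hss : s = s' := (pow_left_inj₀ hs.le hs'.le two_ne_zero).1 (by exact_mod_cast h11)
  subst hss
  have h12 := hi 1 2
  rw [h.inner_one_two, h'.inner_one_two] at h12
  have hw : w = w' := mul_left_cancel₀ (by exact_mod_cast hs.ne') h12
  subst hw
  have h22 := hi 2 2
  rw [h.inner_two_two, h'.inner_two_two, Complex.ofReal_inj] at h22
  have htt : t = t' := (pow_left_inj₀ ht ht' two_ne_zero).1 (by linarith)
  subst htt
  funext j
  refine Subtype.ext ?_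
  fin_cases j
  · exact h.1.trans h'.1.symm
  · exact h.2.1.trans h'.2.1.symm
  · exact h.2.2.trans h'.2.2.symm

theorem HasNormalCoords.center_of_coord_eq {n : ℕ} {z : Ball n} (h : HasNormalCoords x s t w)
    (hz : ∀ i, coord z i = coord (x 0) i) : z = Ball.zero n := by
  refine Ball.ext_coord fun i => ?_
  rw [hz, coord_zero]
  simp only [coord, h.1]
  split_ifs with hi
  · interval_cases i <;> simp
  · rfl

end NormalCoords

/-- Automorphisms that both map a point to the centre agree up to a unitary map. -/
theorem inner_apply_eq_of_apply_eq_zero {n : ℕ} {Φ Ψ : Ball n ≃ Ball n} (hΦ : IsBallAut Φ)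
    (hΨ : IsBallAut Ψ) {a : Ball n} (h : Φ a = Ball.zero n) (h' : Ψ a = Ball.zero n)
    (z w : Ball n) : inner ℂ (Φ z).1 (Φ w).1 = inner ℂ (Ψ z).1 (Ψ w).1 := by
  have := (hΨ.symm.trans hΦ).inner_apply (by simp [← h', h]) (Ψ z) (Ψ w)
  simpa using this

theorem IsNormalFormOf.unique {n : ℕ} {y : Fin 3 → Ball n} {x x' : Fin 3 → Ball 2}
    (h : IsNormalFormOf x y) (h' : IsNormalFormOf x' y) : x = x' := by
  obtain ⟨⟨s, t, w, hs, ht, hx⟩, Φ, hΦ, hΦx⟩ := h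
  obtain ⟨⟨s', t', w', hs', ht', hx'⟩, Ψ, hΨ, hΨx⟩ := h'
  refine hx.eq_of_inner_eq hs hs' ht ht' hx' fun i j => ?_
  rw [← inner_eq_of_coord_eq (hΦx i) (hΦx j), ← inner_eq_of_coord_eq (hΨx i) (hΨx j)]
  exact inner_apply_eq_of_apply_eq_zero hΦ hΨ (hx.center_of_coord_eq (hΦx 0))
    (hx'.center_of_coord_eq (hΨx 0)) _ _

theorem inner_of_mem_horizontalSlice {n : ℕ} {z w : Ball n} (hz : z ∈ horizontalSlice n) :
    inner ℂ z.1 w.1 = coord w 0 * starRingEnd ℂ (coord z 0) := by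
  rw [inner_eq_sum_coord z w (Nat.le_succ n), ← Finset.sum_subset
    (Finset.range_mono (Nat.le_add_left 1 n)) fun i _ hi => ?_, Finset.sum_range_one]
  have hi' : i ≠ 0 := by simpa using hi
  have : coord z i = 0 := by
    by_cases h : i < n
    · simpa [coord, h] using hz ⟨i, h⟩ hi'
    · simp [coord, h]
  simp [this]

theorem moebiusEquiv_mem_horizontalSlice {n : ℕ} {a z : Ball n} (ha : a ∈ horizontalSlice n)
    (hz : z ∈ horizontalSlice n) : moebiusEquiv a z ∈ horizontalSlice n := fun i hi => by
  simp [moebiusEquiv, moebius, ha i hi, hz i hi]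

/-- Points of a geodesic can be moved into the slice with `y 0` at the centre. The matrix of inner
products then has rank one, and its vanishing minor s²(|w|² + t²) - s²|w|² gives t = 0. Conversely,
t = 0 puts the images of the points in the slice. -/
theorem IsNormalFormOf.mem_complexGeodesic_iff {n : ℕ} {y : Fin 3 → Ball n} {x : Fin 3 → Ball 2}
    (h : IsNormalFormOf x y) {s t : ℝ} {w : ℂ} (hs : 0 < s) (hx : HasNormalCoords x s t w) :
    (∃ G : Set (Ball n), IsComplexGeodesic G ∧ ∀ j, y j ∈ G) ↔ t = 0 := by
  obtain ⟨-, Φ, hΦ, hΦx⟩ := h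
  have h0 : Φ (y 0) = Ball.zero n := hx.center_of_coord_eq (hΦx 0)
  constructor
  · rintro ⟨G, ⟨Ψ, hΨ, rfl⟩, hy⟩
    have hz : ∀ j, Ψ.symm (y j) ∈ horizontalSlice n := fun j => by
      obtain ⟨z, hz, hzy⟩ := hy j
      rwa [← hzy, Equiv.symm_apply_apply]
    -- The Möbius map at a point of the slice preserves the slice, so recentring does not leave it.
    obtain ⟨Θ, hΘ, hΘ0, hΘs⟩ : ∃ Θ : Ball n ≃ Ball n, IsBallAut Θ ∧ Θ (y 0) = Ball.zero n ∧
        ∀ j, Θ (y j) ∈ horizontalSlice n :=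
      ⟨Ψ.symm.trans (moebiusEquiv (Ψ.symm (y 0))), hΨ.symm.trans (isBallAut_moebiusEquiv _),
        by rw [Equiv.trans_apply, moebiusEquiv_self], fun j => by
          rw [Equiv.trans_apply]
          exact moebiusEquiv_mem_horizontalSlice (hz 0) (hz j)⟩
    have hi : ∀ i j, inner ℂ (x i).1 (x j).1 =
        coord (Θ (y j)) 0 * starRingEnd ℂ (coord (Θ (y i)) 0) := fun i j => by
      rw [← inner_eq_of_coord_eq (hΦx i) (hΦx j),
        inner_apply_eq_of_apply_eq_zero hΦ hΘ h0 hΘ0, inner_of_mem_horizontalSlice (hΘs i)]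
    have h11 := hi 1 1
    have h12 := hi 1 2
    have h21 := hi 2 1
    have h22 := hi 2 2
    rw [hx.inner_one_one] at h11
    rw [hx.inner_one_two] at h12
    rw [hx.inner_two_one] at h21
    rw [hx.inner_two_two] at h22
    have e : (s : ℂ) ^ 2 * ((‖w‖ ^ 2 + t ^ 2 : ℝ) : ℂ) = (s * w) * (s * starRingEnd ℂ w) := by
      rw [h11, h22, h12, h21]
      ring
    have e' : (s : ℂ) ^ 2 * ((‖w‖ ^ 2 + t ^ 2 : ℝ) : ℂ) = (s : ℂ) ^ 2 * ((‖w‖ ^ 2 : ℝ) : ℂ) := by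
      rw [e, ← Complex.normSq_eq_norm_sq w, ← Complex.mul_conj]
      ring
    have e'' := mul_left_cancel₀ (pow_ne_zero 2 (by exact_mod_cast hs.ne')) e'
    rw [Complex.ofReal_inj] at e''
    exact pow_eq_zero_iff two_ne_zero |>.1 (by linarith)
  · rintro rfl
    refine ⟨_, ⟨Φ.symm, hΦ.symm, rfl⟩, fun j => ⟨Φ (y j), fun i hi => ?_, by simp⟩⟩
    have h1 := hΦx j i
    rw [coord, dif_pos i.2] at h1
    rw [Fin.eta] at h1
    rw [h1, coord]
    split_ifs with h2
    · have h3 : (i : ℕ) = 1 := by omega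
      simp only [h3]
      fin_cases j
      · simp [hx.1]
      · simp [hx.2.1]
      · simp [hx.2.2]
    · rfl

/-! ### The kernel functions and the Pick identity -/

section Kernel

variable {n : ℕ}

theorem inner_kerVec (z : Ball n) (f : DA n) : inner ℂ (kerVec z) f = f z := by
  rw [kerVec, RKHS.kerFun_inner]
  simp

theorem inner_kerVec_kerVec (z w : Ball n) :
    inner ℂ (kerVec z) (kerVec w) = (1 - inner ℂ w.1 z.1)⁻¹ := by
  rw [inner_kerVec, kerVec_apply]

theorem inner_kerVec_ne_zero (z w : Ball n) : inner ℂ (kerVec z) (kerVec w) ≠ 0 := by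
  rw [inner_kerVec_kerVec]
  exact inv_ne_zero (one_sub_inner_ne_zero w.norm_lt z.norm_lt)

theorem norm_kerVec_sq (z : Ball n) : ‖(kerVec z : DA n)‖ ^ 2 = (1 - ‖z.1‖ ^ 2)⁻¹ := by
  have h := inner_kerVec_kerVec z z
  rw [inner_self_eq_ofReal, inner_self_eq_ofReal] at h
  exact_mod_cast h

theorem norm_kerVec_pos (z : Ball n) : 0 < ‖(kerVec z : DA n)‖ := by
  refine norm_pos_iff.2 fun h => inner_kerVec_ne_zero z z ?_
  rw [h, inner_zero_left]

/-- The component of `q` orthogonal to `p`. -/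
def rejection {E : Type*} [NormedAddCommGroup E] [InnerProductSpace ℂ E] (p q : E) : E :=
  q - (inner ℂ p q / inner ℂ p p) • p

theorem inner_rejection_right {E : Type*} [NormedAddCommGroup E] [InnerProductSpace ℂ E]
    {p : E} (hp : p ≠ 0) (q : E) : inner ℂ p (rejection p q) = 0 := by
  have : inner ℂ p p ≠ 0 := inner_self_ne_zero.2 hp
  rw [rejection, inner_sub_right, inner_smul_right, div_mul_cancel₀ _ this, sub_self]

theorem inner_rejection_rejection {E : Type*} [NormedAddCommGroup E] [InnerProductSpace ℂ E]
    {p : E} (hp : p ≠ 0) (q r : E) : inner ℂ (rejection p q) (rejection p r) =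
      inner ℂ q r - inner ℂ q p * inner ℂ p r / inner ℂ p p := by
  nth_rewrite 1 [rejection]
  rw [inner_sub_left, inner_smul_left, inner_rejection_right hp, mul_zero, sub_zero, rejection,
    inner_sub_right, inner_smul_right]
  ring

/-- The complete Pick property of the Drury–Arveson kernel. -/
theorem inner_rejection_kerVec (a z w : Ball n) :
    inner ℂ (rejection (kerVec a) (kerVec z)) (rejection (kerVec a) (kerVec w)) =
      inner ℂ (kerVec z) (kerVec w) * inner ℂ (moebius a.1 w.1) (moebius a.1 z.1) := by
  have h := one_sub_inner_moebius a.norm_lt z.norm_lt w.norm_lt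
  have h1 := one_sub_inner_ne_zero a.norm_lt a.norm_lt
  have h2 := one_sub_inner_ne_zero w.norm_lt z.norm_lt
  have h3 := one_sub_inner_ne_zero w.norm_lt a.norm_lt
  have h4 := one_sub_inner_ne_zero a.norm_lt z.norm_lt
  -- Writing the Möbius inner product as 1 - (1 - ·) lets `one_sub_inner_moebius` replace it by a
  -- rational expression in kernels.
  rw [inner_rejection_rejection (norm_pos_iff.1 (norm_kerVec_pos a)), ← sub_sub_cancel (1 : ℂ)
    (inner ℂ (moebius a.1 w.1) (moebius a.1 z.1)), h]
  simp only [inner_kerVec_kerVec]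
  field_simp

theorem norm_rejection_kerVec (a z : Ball n) :
    ‖rejection (kerVec a : DA n) (kerVec z)‖ = ‖(kerVec z : DA n)‖ * ‖moebius a.1 z.1‖ := by
  have h := inner_rejection_kerVec a z z
  rw [inner_self_eq_ofReal, inner_self_eq_ofReal, inner_self_eq_ofReal, ← Complex.ofReal_mul,
    Complex.ofReal_inj, ← mul_pow] at h
  exact (pow_left_inj₀ (norm_nonneg _) (by positivity) two_ne_zero).1 h

theorem moebius_eq_zero_iff {a z : Ball n} : moebius a.1 z.1 = 0 ↔ z = a := by
  constructor
  · intro h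
    have h1 : moebiusEquiv a z = moebiusEquiv a a := by
      rw [moebiusEquiv_self]
      exact Subtype.ext h
    exact (moebiusEquiv a).injective h1
  · rintro rfl
    exact moebius_self z.norm_lt

theorem norm_moebius_pos {a z : Ball n} (h : z ≠ a) : 0 < ‖moebius a.1 z.1‖ :=
  norm_pos_iff.2 fun h' => h (moebius_eq_zero_iff.1 h')

theorem norm_moebius_sq (a z : Ball n) : ‖moebius a.1 z.1‖ ^ 2 =
    1 - ‖inner ℂ (kerVec a) (kerVec z)‖ ^ 2 / (‖(kerVec a : DA n)‖ ^ 2 * ‖(kerVec z : DA n)‖ ^ 2) := by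
  have hz := norm_kerVec_pos z
  have ha := norm_kerVec_pos a
  have h := inner_rejection_rejection (norm_pos_iff.1 ha) (kerVec z) (kerVec z)
  have e : inner ℂ (kerVec z) (kerVec a) * inner ℂ (kerVec a) (kerVec z) =
      ((‖inner ℂ (kerVec a) (kerVec z)‖ ^ 2 : ℝ) : ℂ) := by
    rw [← Complex.normSq_eq_norm_sq, Complex.normSq_eq_conj_mul_self, inner_conj_symm]
  rw [e, inner_self_eq_ofReal, inner_self_eq_ofReal, inner_self_eq_ofReal,
    norm_rejection_kerVec] at h
  have h' : (‖(kerVec z : DA n)‖ * ‖moebius a.1 z.1‖) ^ 2 = ‖(kerVec z : DA n)‖ ^ 2 -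
      ‖inner ℂ (kerVec a) (kerVec z)‖ ^ 2 / ‖(kerVec a : DA n)‖ ^ 2 := by
    exact_mod_cast h
  field_simp at h' ⊢
  linarith

/-- The defect in Cauchy–Schwarz is a positive multiple of ‖moebius‖², which vanishes only when the
points coincide. -/
theorem norm_inner_kerVec_lt {z w : Ball n} (h : z ≠ w) :
    ‖inner ℂ (kerVec z) (kerVec w)‖ ^ 2 < ‖(kerVec z : DA n)‖ ^ 2 * ‖(kerVec w : DA n)‖ ^ 2 := by
  have h1 := norm_moebius_sq z w
  have h2 := pow_pos (norm_moebius_pos h.symm) 2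
  have hz := norm_kerVec_pos z
  have hw := norm_kerVec_pos w
  rw [h1, sub_pos, div_lt_one (by positivity)] at h2
  exact h2

theorem gram_self_re {ι : Type*} (x : ι → Ball n) (i : ι) :
    (gram x i i).re = ‖(kerVec (x i) : DA n)‖ ^ 2 := by
  rw [gram, inner_self_eq_ofReal, Complex.ofReal_re]

theorem delta_comm {ι : Type*} (x : ι → Ball n) (i j : ι) : delta x i j = delta x j i := by
  have h : ‖gram x i j‖ = ‖gram x j i‖ := norm_inner_symm _ _
  rw [delta, delta, mul_comm, h]

theorem delta_eq_norm_moebius {ι : Type*} (x : ι → Ball n) (i j : ι) :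
    delta x i j = ‖moebius (x i).1 (x j).1‖ := by
  rw [delta, gram_self_re, gram_self_re, gram, norm_inner_symm, ← norm_moebius_sq,
    Real.sqrt_sq (norm_nonneg _)]

/-- Project away from the first kernel. By the Pick identity the Gram matrix of the two rejections
is the entrywise product of a kernel Gram matrix, with strict Cauchy–Schwarz, and a Gram matrix of
Möbius images. Its determinant is therefore positive. -/
theorem linearIndependent_kerVec {x : Fin 3 → Ball n} (hx : Function.Injective x) :
    LinearIndependent ℂ fun i => (kerVec (x i) : DA n) := by
  rw [Fintype.linearIndependent_iff]
  intro c hc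
  rw [Fin.sum_univ_three] at hc
  have hp := norm_pos_iff.1 (norm_kerVec_pos (x 0))
  set p : DA n := kerVec (x 0)
  set q : DA n := kerVec (x 1)
  set r : DA n := kerVec (x 2)
  have hqr : c 1 • rejection p q + c 2 • rejection p r = 0 := by
    have h1 : inner ℂ p (c 0 • p + c 1 • q + c 2 • r) = 0 := by rw [hc, inner_zero_right]
    rw [inner_add_right, inner_add_right, inner_smul_right, inner_smul_right,
      inner_smul_right] at h1
    have hpp : inner ℂ p p ≠ 0 := inner_self_ne_zero.2 hp
    have h2 : c 1 • rejection p q + c 2 • rejection p r = (c 0 • p + c 1 • q + c 2 • r) -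
        ((c 0 * inner ℂ p p + c 1 * inner ℂ p q + c 2 * inner ℂ p r) / inner ℂ p p) • p := by
      unfold rejection
      match_scalars <;> field_simp
      ring
    rw [h2, hc, h1, zero_div, zero_smul, sub_zero]
  have hq : inner ℂ (rejection p q) (rejection p q) = ((‖rejection p q‖ ^ 2 : ℝ) : ℂ) :=
    inner_self_eq_ofReal _
  have hr : inner ℂ (rejection p r) (rejection p r) = ((‖rejection p r‖ ^ 2 : ℝ) : ℂ) :=
    inner_self_eq_ofReal _
  have hlt : ‖inner ℂ (rejection p q) (rejection p r)‖ ^ 2 <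
      ‖rejection p q‖ ^ 2 * ‖rejection p r‖ ^ 2 := by
    rw [inner_rejection_kerVec, norm_rejection_kerVec, norm_rejection_kerVec, norm_mul]
    have h1 := norm_inner_kerVec_lt (hx.ne (show (1 : Fin 3) ≠ 2 by decide))
    have h2 : ‖inner ℂ (moebius (x 0).1 (x 2).1) (moebius (x 0).1 (x 1).1)‖ ≤ _ :=
      norm_inner_le_norm _ _
    have h3 := norm_moebius_pos (hx.ne (show (1 : Fin 3) ≠ 0 by decide))
    have h4 := norm_moebius_pos (hx.ne (show (2 : Fin 3) ≠ 0 by decide))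
    calc _ = _ := mul_pow _ _ _
      _ ≤ ‖inner ℂ q r‖ ^ 2 *
          (‖moebius (x 0).1 (x 2).1‖ * ‖moebius (x 0).1 (x 1).1‖) ^ 2 := by gcongr
      _ < (‖q‖ ^ 2 * ‖r‖ ^ 2) *
          (‖moebius (x 0).1 (x 2).1‖ * ‖moebius (x 0).1 (x 1).1‖) ^ 2 := by gcongr
      _ = _ := by ring
  have hB : inner ℂ (rejection p q) (rejection p r) * inner ℂ (rejection p r) (rejection p q) =
      ((‖inner ℂ (rejection p q) (rejection p r)‖ ^ 2 : ℝ) : ℂ) := by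
    rw [← Complex.normSq_eq_norm_sq, Complex.normSq_eq_conj_mul_self, inner_conj_symm, mul_comm]
  have e1 : inner ℂ (rejection p q) (c 1 • rejection p q + c 2 • rejection p r) = 0 := by
    rw [hqr, inner_zero_right]
  have e2 : inner ℂ (rejection p r) (c 1 • rejection p q + c 2 • rejection p r) = 0 := by
    rw [hqr, inner_zero_right]
  rw [inner_add_right, inner_smul_right, inner_smul_right] at e1 e2
  have hdet : inner ℂ (rejection p q) (rejection p q) * inner ℂ (rejection p r) (rejection p r) -
      inner ℂ (rejection p q) (rejection p r) * inner ℂ (rejection p r) (rejection p q) ≠ 0 := by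
    rw [hB, hq, hr]
    exact_mod_cast (sub_pos.2 hlt).ne'
  -- Cramer's rule for the 2×2 system `e1`, `e2`.
  have h1 : c 1 = 0 := by
    refine (mul_eq_zero.1 (?_ : _ * c 1 = 0)).resolve_left hdet
    linear_combination inner ℂ (rejection p r) (rejection p r) * e1 -
      inner ℂ (rejection p q) (rejection p r) * e2
  have h2 : c 2 = 0 := by
    refine (mul_eq_zero.1 (?_ : _ * c 2 = 0)).resolve_left hdet
    linear_combination inner ℂ (rejection p q) (rejection p q) * e2 -
      inner ℂ (rejection p r) (rejection p q) * e1
  rw [h1, h2, zero_smul, zero_smul, add_zero, add_zero] at hc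
  intro i
  fin_cases i
  · exact (smul_eq_zero.1 hc).resolve_right hp
  · exact h1
  · exact h2

end Kernel

/-! ### Multipliers and their contractivity -/

section Multipliers

variable {ι : Type*} {n : ℕ} {x : ι → Ball n}

/-- The kernel function of `DA_n(X)` at the point `x_i`. -/
def kerSub (x : ι → Ball n) (i : ι) : DASub x :=
  ⟨kerVec (x i), Submodule.subset_span ⟨i, rfl⟩⟩

theorem inner_kerSub (i : ι) (h : DASub x) : inner ℂ (kerSub x i) h = (h : DA n) (x i) :=
  inner_kerVec (x i) (h : DA n)

theorem DASub.inner_smul_left (c : ℂ) (u v : DASub x) :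
    inner ℂ (c • u) v = starRingEnd ℂ c * inner ℂ u v := by
  change inner ℂ ((c • u : DASub x) : DA n) (v : DA n) = _
  rw [Submodule.coe_smul, _root_.inner_smul_left]
  rfl

theorem DASub.ext_apply {h h' : DASub x} (H : ∀ i, (h : DA n) (x i) = (h' : DA n) (x i)) :
    h = h' := by
  refine sub_eq_zero.1 ?_
  have key : ∀ v ∈ DASub x, inner ℂ v ((h - h' : DASub x) : DA n) = 0 := by
    intro v hv
    induction hv using Submodule.span_induction with
    | mem v hv =>
      obtain ⟨i, rfl⟩ := hv
      rw [inner_kerVec]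
      simp [H i]
    | zero => exact inner_zero_left _
    | add u v _ _ hu hv => rw [inner_add_left, hu, hv, add_zero]
    | smul c v _ hv => rw [_root_.inner_smul_left, hv, mul_zero]
  exact Subtype.ext ((inner_self_eq_zero (𝕜 := ℂ)).1 (key _ (h - h').2))

theorem Multiplier.ext_symbol {m m' : Multiplier x} (h : m.symbol = m'.symbol) : m = m' := by
  refine Multiplier.ext h (ContinuousLinearMap.ext fun v => DASub.ext_apply fun i => ?_)
  rw [m.op_apply, m'.op_apply, h]

instance [Finite ι] : FiniteDimensional ℂ (DASub x) :=
  FiniteDimensional.span_of_finite ℂ (Set.finite_range _)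

/-- Evaluation on X is injective between spaces of equal dimension, hence onto. -/
theorem exists_apply_eq [Finite ι] (hx : LinearIndependent ℂ fun i => (kerVec (x i) : DA n))
    (f : ι → ℂ) : ∃ h : DASub x, ∀ i, (h : DA n) (x i) = f i := by
  have := Fintype.ofFinite ι
  let ev : DASub x →ₗ[ℂ] (ι → ℂ) :=
    { toFun := fun h i => (h : DA n) (x i)
      map_add' := fun h h' => by ext i; simp
      map_smul' := fun c h => by ext i; simp }
  have hinj : Function.Injective ev := fun h h' H => DASub.ext_apply fun i => congrFun H i
  have hdim : Module.finrank ℂ (DASub x) = Module.finrank ℂ (ι → ℂ) := by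
    rw [Module.finrank_fintype_fun_eq_card]
    exact finrank_span_eq_card hx
  obtain ⟨h, hh⟩ := (LinearMap.injective_iff_surjective_of_finrank_eq_finrank hdim).1 hinj f
  exact ⟨h, fun i => congrFun hh i⟩

theorem Multiplier.exists_symbol_eq [Finite ι]
    (hx : LinearIndependent ℂ fun i => (kerVec (x i) : DA n)) (f : ι → ℂ) :
    ∃ m : Multiplier x, m.symbol = f := by
  choose T hT using fun h : DASub x => exists_apply_eq hx fun i => f i * (h : DA n) (x i)
  let T' : DASub x →ₗ[ℂ] DASub x :=
    { toFun := T
      map_add' := fun h h' => DASub.ext_apply fun i => by simp [hT, mul_add]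
      map_smul' := fun c h => DASub.ext_apply fun i => by simp [hT, mul_left_comm] }
  exact ⟨⟨f, LinearMap.toContinuousLinearMap T', fun h i => hT h i⟩, rfl⟩

theorem Multiplier.adjoint_op_kerSub [Finite ι] (m : Multiplier x) (i : ι) :
    ContinuousLinearMap.adjoint m.op (kerSub x i) = starRingEnd ℂ (m.symbol i) • kerSub x i := by
  refine ext_inner_right ℂ fun v => ?_
  rw [ContinuousLinearMap.adjoint_inner_left, DASub.inner_smul_left, inner_kerSub, inner_kerSub,
    m.op_apply, Complex.conj_conj]

theorem Multiplier.norm_def (m : Multiplier x) : ‖m‖ = ‖m.op‖ := rfl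

theorem Multiplier.norm_smul (c : ℂ) (m : Multiplier x) : ‖c • m‖ = ‖c‖ * ‖m‖ :=
  @_root_.norm_smul ℂ (DASub x →L[ℂ] DASub x) _ _ _ NormedSpace.toNormSMulClass c m.op

theorem Multiplier.symbol_smul (c : ℂ) (m : Multiplier x) (i : ι) :
    (c • m).symbol i = c * m.symbol i := rfl

theorem Multiplier.symbol_mul (m m' : Multiplier x) (i : ι) :
    (m * m').symbol i = m.symbol i * m'.symbol i := rfl

theorem Multiplier.norm_nonneg (m : Multiplier x) : 0 ≤ ‖m‖ := _root_.norm_nonneg m.op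

theorem norm_add_sq_of_orthogonal {E : Type*} [NormedAddCommGroup E] [InnerProductSpace ℂ E]
    {u v : E} (h : inner ℂ u v = 0) : ‖u + v‖ ^ 2 = ‖u‖ ^ 2 + ‖v‖ ^ 2 := by
  rw [@norm_add_sq ℂ, h]
  simp

theorem norm_smul_add_smul_sq {E : Type*} [NormedAddCommGroup E] [InnerProductSpace ℂ E]
    (b c : ℂ) (u v : E) : ‖b • u + c • v‖ ^ 2 = ‖b‖ ^ 2 * ‖u‖ ^ 2 + ‖c‖ ^ 2 * ‖v‖ ^ 2 +
      2 * (starRingEnd ℂ b * c * inner ℂ u v).re := by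
  rw [@norm_add_sq ℂ, inner_smul_left, inner_smul_right, norm_smul, norm_smul, mul_pow, mul_pow,
    ← mul_assoc]
  simp only [RCLike.re_eq_complex_re]
  ring

/-- For fixed b and c the norm on the left is smallest when a cancels the component along P. What
remains is the same combination of the rejections. -/
theorem norm_le_norm_smul_add_iff {E : Type*} [NormedAddCommGroup E] [InnerProductSpace ℂ E]
    {P : E} (hP : P ≠ 0) (Q R : E) (N : ℂ → ℂ → ℝ) (hN : ∀ b c, 0 ≤ N b c) :
    (∀ a b c : ℂ, N b c ≤ ‖a • P + b • Q + c • R‖) ↔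
      ∀ b c : ℂ, N b c ^ 2 ≤ ‖b • rejection P Q + c • rejection P R‖ ^ 2 := by
  have hrej : ∀ a b c : ℂ, a • P + b • Q + c • R =
      (a + (b * (inner ℂ P Q / inner ℂ P P) + c * (inner ℂ P R / inner ℂ P P))) • P +
        (b • rejection P Q + c • rejection P R) := by
    intro a b c
    unfold rejection
    module
  constructor
  · intro h b c
    have h1 := h (-(b * (inner ℂ P Q / inner ℂ P P) + c * (inner ℂ P R / inner ℂ P P))) b c
    rw [hrej, neg_add_cancel, zero_smul, zero_add] at h1
    exact pow_le_pow_left₀ (hN b c) h1 2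
  · intro h a b c
    rw [hrej]
    refine (sq_le_sq₀ (hN b c) (norm_nonneg _)).1 ((h b c).trans ?_)
    have horth : inner ℂ ((a + (b * (inner ℂ P Q / inner ℂ P P) +
        c * (inner ℂ P R / inner ℂ P P))) • P) (b • rejection P Q + c • rejection P R) = 0 := by
      rw [inner_smul_left, inner_add_right, inner_smul_right, inner_smul_right,
        inner_rejection_right hP, inner_rejection_right hP]
      simp
    rw [norm_add_sq_of_orthogonal horth]
    exact le_add_of_nonneg_left (sq_nonneg _)

theorem norm_smul_kerSub_add (i j : ι) (b c : ℂ) :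
    ‖b • kerSub x i + c • kerSub x j‖ = ‖b • (kerVec (x i) : DA n) + c • (kerVec (x j) : DA n)‖ := by
  rfl

theorem norm_smul_kerSub_add_add (i j k : ι) (a b c : ℂ) :
    ‖a • kerSub x i + b • kerSub x j + c • kerSub x k‖ =
      ‖a • (kerVec (x i) : DA n) + b • (kerVec (x j) : DA n) + c • (kerVec (x k) : DA n)‖ := by
  rfl

/-- The adjoint has the same norm and acts diagonally on the kernel functions, which span the space;
the term at p is killed. -/
theorem Multiplier.norm_le_one_iff_adjoint {x : Fin 3 → Ball n} {p q r : Fin 3}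
    (hpqr : ∀ i, i = p ∨ i = q ∨ i = r) {m : Multiplier x} (hm : m.symbol p = 0) :
    ‖m‖ ≤ 1 ↔ ∀ a b c : ℂ, ‖(starRingEnd ℂ (m.symbol q) * b) • (kerVec (x q) : DA n) +
        (starRingEnd ℂ (m.symbol r) * c) • (kerVec (x r) : DA n)‖ ≤
      ‖a • (kerVec (x p) : DA n) + b • (kerVec (x q) : DA n) + c • (kerVec (x r) : DA n)‖ := by
  have hadj : ∀ a b c : ℂ, ContinuousLinearMap.adjoint m.op
      (a • kerSub x p + b • kerSub x q + c • kerSub x r) =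
      (starRingEnd ℂ (m.symbol q) * b) • kerSub x q +
        (starRingEnd ℂ (m.symbol r) * c) • kerSub x r := by
    intro a b c
    rw [map_add, map_add, map_smul, map_smul, map_smul, m.adjoint_op_kerSub,
      m.adjoint_op_kerSub, m.adjoint_op_kerSub, hm]
    simp only [map_zero, zero_smul, smul_zero, zero_add, smul_smul]
    rw [mul_comm b, mul_comm c]
  have hspan : ∀ v : DASub x, ∃ a b c : ℂ,
      v = a • kerSub x p + b • kerSub x q + c • kerSub x r := by
    intro v
    obtain ⟨a, b, c, hv⟩ : ∃ a b c : ℂ, a • (kerVec (x p) : DA n) + b • (kerVec (x q) : DA n) +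
        c • (kerVec (x r) : DA n) = (v : DA n) := by
      refine Submodule.mem_span_triple.1 (Submodule.span_mono ?_ v.2)
      rintro _ ⟨i, rfl⟩
      rcases hpqr i with rfl | rfl | rfl <;> simp
    exact ⟨a, b, c, Subtype.ext hv.symm⟩
  have key : ‖m‖ ≤ 1 ↔ ∀ v, ‖ContinuousLinearMap.adjoint m.op v‖ ≤ ‖v‖ := by
    rw [m.norm_def, ← LinearIsometryEquiv.norm_map ContinuousLinearMap.adjoint m.op]
    constructor
    · intro h v
      simpa using ContinuousLinearMap.le_of_opNorm_le _ h v
    · intro h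
      exact ContinuousLinearMap.opNorm_le_bound _ zero_le_one fun v => by simpa using h v
  rw [key]
  constructor
  · intro h a b c
    have h1 := h (a • kerSub x p + b • kerSub x q + c • kerSub x r)
    rwa [hadj, norm_smul_kerSub_add, norm_smul_kerSub_add_add] at h1
  · intro h v
    refine (hspan v).elim fun a ha => ha.elim fun b hb => hb.elim fun c hv => ?_
    rw [hv, hadj, norm_smul_kerSub_add, norm_smul_kerSub_add_add]
    exact h a b c

/-- A multiplier vanishing at `x_p` is contractive if and only if a Hermitian form in two
variables is positive semidefinite. -/
theorem Multiplier.norm_le_one_iff {x : Fin 3 → Ball n} {p q r : Fin 3}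
    (hpqr : ∀ i, i = p ∨ i = q ∨ i = r) {m : Multiplier x} (hm : m.symbol p = 0) :
    ‖m‖ ≤ 1 ↔ ∀ b c : ℂ, 0 ≤
      ‖b‖ ^ 2 * (‖(kerVec (x q) : DA n)‖ ^ 2 *
        (‖moebius (x p).1 (x q).1‖ ^ 2 - ‖m.symbol q‖ ^ 2)) +
      ‖c‖ ^ 2 * (‖(kerVec (x r) : DA n)‖ ^ 2 *
        (‖moebius (x p).1 (x r).1‖ ^ 2 - ‖m.symbol r‖ ^ 2)) +
      2 * (starRingEnd ℂ b * c * (inner ℂ (kerVec (x q)) (kerVec (x r)) *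
        (inner ℂ (moebius (x p).1 (x r).1) (moebius (x p).1 (x q).1) -
          m.symbol q * starRingEnd ℂ (m.symbol r)))).re := by
  set P : DA n := kerVec (x p) with hP
  set Q : DA n := kerVec (x q) with hQ
  set R : DA n := kerVec (x r) with hR
  have hP0 : P ≠ 0 := norm_pos_iff.1 (norm_kerVec_pos (x p))
  have form : ∀ b c : ℂ,
      ‖b‖ ^ 2 * (‖Q‖ ^ 2 * (‖moebius (x p).1 (x q).1‖ ^ 2 - ‖m.symbol q‖ ^ 2)) +
      ‖c‖ ^ 2 * (‖R‖ ^ 2 * (‖moebius (x p).1 (x r).1‖ ^ 2 - ‖m.symbol r‖ ^ 2)) +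
      2 * (starRingEnd ℂ b * c * (inner ℂ Q R *
        (inner ℂ (moebius (x p).1 (x r).1) (moebius (x p).1 (x q).1) -
          m.symbol q * starRingEnd ℂ (m.symbol r)))).re =
      ‖b • rejection P Q + c • rejection P R‖ ^ 2 -
        ‖(starRingEnd ℂ (m.symbol q) * b) • Q + (starRingEnd ℂ (m.symbol r) * c) • R‖ ^ 2 := by
    intro b c
    rw [norm_smul_add_smul_sq, norm_smul_add_smul_sq, inner_rejection_kerVec,
      norm_rejection_kerVec, norm_rejection_kerVec, norm_mul, norm_mul, RCLike.norm_conj,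
      RCLike.norm_conj, map_mul, Complex.conj_conj]
    have : (starRingEnd ℂ b * c * (inner ℂ Q R *
        (inner ℂ (moebius (x p).1 (x r).1) (moebius (x p).1 (x q).1) -
          m.symbol q * starRingEnd ℂ (m.symbol r)))).re =
        (starRingEnd ℂ b * c * (inner ℂ Q R *
          inner ℂ (moebius (x p).1 (x r).1) (moebius (x p).1 (x q).1))).re -
        (m.symbol q * starRingEnd ℂ b * (starRingEnd ℂ (m.symbol r) * c) * inner ℂ Q R).re := by
      rw [← Complex.sub_re]
      congr 1
      ring
    rw [this]
    ring
  rw [Multiplier.norm_le_one_iff_adjoint hpqr hm, norm_le_norm_smul_add_iff hP0 Q R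
    (fun b c => ‖(starRingEnd ℂ (m.symbol q) * b) • Q + (starRingEnd ℂ (m.symbol r) * c) • R‖)
    fun _ _ => _root_.norm_nonneg _]
  simp only [form, sub_nonneg]

end Multipliers

/-- In a positive semidefinite matrix, a zero on the diagonal forces a zero row. -/
theorem nonneg_of_hermitian_form_nonneg {A C : ℝ} {B : ℂ} (h : ∀ b c : ℂ,
    0 ≤ ‖b‖ ^ 2 * A + ‖c‖ ^ 2 * C + 2 * (starRingEnd ℂ b * c * B).re) :
    0 ≤ A ∧ (A = 0 → B = 0) := by
  refine ⟨by simpa using h 1 0, fun hA => ?_⟩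
  by_contra hB
  have hB' : 0 < ‖B‖ ^ 2 := by positivity
  -- With A = 0 and c = 1, this b makes the form equal to C - (C + 1) = -1.
  have h1 := h ((-((C + 1) / (2 * ‖B‖ ^ 2)) : ℝ) * B) 1
  have e : starRingEnd ℂ ((-((C + 1) / (2 * ‖B‖ ^ 2)) : ℝ) * B) * 1 * B =
      ((-((C + 1) / (2 * ‖B‖ ^ 2)) * ‖B‖ ^ 2 : ℝ) : ℂ) := by
    rw [Complex.ofReal_mul, ← Complex.normSq_eq_norm_sq B, Complex.normSq_eq_conj_mul_self, map_mul,
      Complex.conj_ofReal]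
    ring
  rw [e, Complex.ofReal_re, hA, norm_one, mul_zero, one_pow, one_mul, zero_add] at h1
  have e' : -((C + 1) / (2 * ‖B‖ ^ 2)) * ‖B‖ ^ 2 = -(C + 1) / 2 := by
    field_simp
  rw [e'] at h1
  linarith

theorem eq_ofReal_of_norm_le_re {z : ℂ} {r : ℝ} (h : ‖z‖ ≤ r) (h' : r ≤ z.re) : z = r := by
  have h1 : z.re = r := le_antisymm ((Complex.re_le_norm z).trans h) h'
  have h2 := Complex.sq_norm_sub_sq_re z
  have h3 : ‖z‖ ^ 2 ≤ r ^ 2 := pow_le_pow_left₀ (_root_.norm_nonneg _) h 2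
  have h4 : z.im = 0 := by
    refine pow_eq_zero_iff two_ne_zero |>.1 (le_antisymm ?_ (sq_nonneg _))
    rw [← h2, h1]
    linarith
  exact Complex.ext (by simpa using h1) (by simpa using h4)

/-! ### Extremal multipliers and extremal values -/

section Extremal

variable {n : ℕ} {x : Fin 3 → Ball n}

theorem Multiplier.norm_eq_one_of_forall_smul {ι : Type*} {x : ι → Ball n} {m : Multiplier x}
    (h : ‖m‖ ≤ 1) (hmax : ∀ c : ℝ, 0 < c → ‖(c : ℂ) • m‖ ≤ 1 → c ≤ 1) : ‖m‖ = 1 := by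
  refine h.antisymm (not_lt.1 fun hlt => ?_)
  have h0 := m.norm_nonneg
  -- This factor exceeds 1 when ‖m‖ < 1 and keeps the norm at most 1; unlike 1/‖m‖ it also serves
  -- ‖m‖ = 0.
  have hpos : 0 < 2 / (1 + ‖m‖) := by positivity
  have h1 := hmax (2 / (1 + ‖m‖)) hpos (by
    rw [Multiplier.norm_smul, Complex.norm_real, Real.norm_of_nonneg hpos.le, div_mul_eq_mul_div,
      div_le_one (by positivity)]
    linarith)
  rw [div_le_one (by positivity)] at h1
  linarith

/-- The bound is nonnegativity of a diagonal entry of the Hermitian form. In case of equality the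
off-diagonal entry vanishes, which ties the value at r to the value at q; this is why the extremal
multiplier is unique. -/
theorem Multiplier.norm_symbol_le {p q r : Fin 3} (hpqr : ∀ i, i = p ∨ i = q ∨ i = r)
    {m : Multiplier x} (hp : m.symbol p = 0) (hm : ‖m‖ ≤ 1) :
    ‖m.symbol q‖ ≤ ‖moebius (x p).1 (x q).1‖ ∧
      (‖m.symbol q‖ = ‖moebius (x p).1 (x q).1‖ →
        inner ℂ (moebius (x p).1 (x r).1) (moebius (x p).1 (x q).1) =
          m.symbol q * starRingEnd ℂ (m.symbol r)) := by
  have h := nonneg_of_hermitian_form_nonneg ((Multiplier.norm_le_one_iff hpqr hp).1 hm)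
  constructor
  · have h2 := (mul_nonneg_iff_of_pos_left (pow_pos (norm_kerVec_pos (x q)) 2)).1 h.1
    exact (sq_le_sq₀ (_root_.norm_nonneg _) (_root_.norm_nonneg _)).1 (sub_nonneg.1 h2)
  · intro e
    have h1 := h.2 (by rw [e, sub_self, mul_zero])
    exact sub_eq_zero.1 ((mul_eq_zero.1 h1).resolve_left (inner_kerVec_ne_zero _ _))

theorem exists_extremal_multiplier (hx : Function.Injective x) {p q r : Fin 3}
    (hpqr : ∀ i, i = p ∨ i = q ∨ i = r) (hpq : p ≠ q) (hpr : p ≠ r) (hqr : q ≠ r) :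
    ∃ m : Multiplier x, m.symbol p = 0 ∧ m.symbol q = ‖moebius (x p).1 (x q).1‖ ∧
      m.symbol r = inner ℂ (moebius (x p).1 (x q).1) (moebius (x p).1 (x r).1) /
        ‖moebius (x p).1 (x q).1‖ ∧ ‖m‖ = 1 := by
  obtain ⟨m, hm⟩ := Multiplier.exists_symbol_eq (linearIndependent_kerVec hx)
    (fun i => if i = p then (0 : ℂ) else if i = q then (‖moebius (x p).1 (x q).1‖ : ℂ) else
      inner ℂ (moebius (x p).1 (x q).1) (moebius (x p).1 (x r).1) / ‖moebius (x p).1 (x q).1‖)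
  have hmp : m.symbol p = 0 := by simp [hm]
  have hmq : m.symbol q = ‖moebius (x p).1 (x q).1‖ := by simp [hm, hpq.symm]
  have hmr : m.symbol r = inner ℂ (moebius (x p).1 (x q).1) (moebius (x p).1 (x r).1) /
      ‖moebius (x p).1 (x q).1‖ := by simp [hm, hpr.symm, hqr.symm]
  have hδ : 0 < ‖moebius (x p).1 (x q).1‖ := norm_moebius_pos (hx.ne hpq.symm)
  have hδ' : (‖moebius (x p).1 (x q).1‖ : ℂ) ≠ 0 := by exact_mod_cast hδ.ne'
  have hle : ‖m‖ ≤ 1 := by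
    rw [Multiplier.norm_le_one_iff hpqr hmp]
    intro b c
    -- The value at r is chosen to annihilate the off-diagonal entry. The entry at q is zero as
    -- well, so only the entry at r is left, and Cauchy–Schwarz makes it nonnegative.
    have e : inner ℂ (moebius (x p).1 (x r).1) (moebius (x p).1 (x q).1) -
          m.symbol q * starRingEnd ℂ (m.symbol r) = 0 := by
      rw [hmq, hmr, map_div₀, Complex.conj_ofReal, inner_conj_symm, mul_div_cancel₀ _ hδ', sub_self]
    rw [e, hmq, Complex.norm_real, norm_norm, sub_self]
    simp only [mul_zero, Complex.zero_re, zero_add, add_zero]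
    refine mul_nonneg (sq_nonneg _) (mul_nonneg (sq_nonneg _) (sub_nonneg.2 ?_))
    refine pow_le_pow_left₀ (_root_.norm_nonneg _) ?_ 2
    rw [hmr, norm_div, Complex.norm_real, norm_norm, div_le_iff₀ hδ, mul_comm]
    exact norm_inner_le_norm _ _
  refine ⟨m, hmp, hmq, hmr, Multiplier.norm_eq_one_of_forall_smul hle fun c hc hcm => ?_⟩
  have h1 := (Multiplier.norm_symbol_le hpqr (m := (c : ℂ) • m)
    (by rw [Multiplier.symbol_smul, hmp, mul_zero]) hcm).1
  rw [Multiplier.symbol_smul, hmq, norm_mul, Complex.norm_real, Complex.norm_real, norm_norm,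
    Real.norm_of_nonneg hc.le] at h1
  exact le_of_mul_le_mul_right (h1.trans_eq (one_mul _).symm) hδ

theorem isExtremal_singleton_iff (hx : Function.Injective x) {p q r : Fin 3}
    (hpqr : ∀ i, i = p ∨ i = q ∨ i = r) (hpq : p ≠ q) (hpr : p ≠ r) (hqr : q ≠ r)
    (m : Multiplier x) : IsExtremal {p} q m ↔
      m.symbol p = 0 ∧ m.symbol q = ‖moebius (x p).1 (x q).1‖ ∧
      m.symbol r = inner ℂ (moebius (x p).1 (x q).1) (moebius (x p).1 (x r).1) /
        ‖moebius (x p).1 (x q).1‖ := by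
  obtain ⟨M, hMp, hMq, hMr, hM⟩ := exists_extremal_multiplier hx hpqr hpq hpr hqr
  have hδ : 0 < ‖moebius (x p).1 (x q).1‖ := norm_moebius_pos (hx.ne hpq.symm)
  have hδ' : (‖moebius (x p).1 (x q).1‖ : ℂ) ≠ 0 := by exact_mod_cast hδ.ne'
  constructor
  · rintro ⟨⟨hm1, hmp⟩, hmax⟩
    have hmp : m.symbol p = 0 := hmp p rfl
    have h := Multiplier.norm_symbol_le hpqr hmp hm1.le
    have h1 := hmax M ⟨hM, by rintro _ rfl; exact hMp⟩
    rw [hMq, Complex.ofReal_re] at h1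
    have hmq := eq_ofReal_of_norm_le_re h.1 h1
    refine ⟨hmp, hmq, ?_⟩
    have h2 := congrArg (starRingEnd ℂ) (h.2 (by rw [hmq, Complex.norm_real, norm_norm]))
    rw [inner_conj_symm, hmq, map_mul, Complex.conj_conj, Complex.conj_ofReal] at h2
    rw [h2, mul_div_cancel_left₀ _ hδ']
  · rintro ⟨hmp, hmq, hmr⟩
    have e : m = M := Multiplier.ext_symbol (funext fun i => by
      rcases hpqr i with rfl | rfl | rfl
      · rw [hmp, hMp]
      · rw [hmq, hMq]
      · rw [hmr, hMr])
    subst e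
    refine ⟨⟨hM, by rintro _ rfl; exact hmp⟩, fun m' hm' => ?_⟩
    rw [hmq, Complex.ofReal_re]
    exact (Complex.re_le_norm _).trans (Multiplier.norm_symbol_le hpqr (hm'.2 p rfl) hm'.1.le).1

theorem existsUnique_isExtremal_singleton (hx : Function.Injective x) {p q r : Fin 3}
    (hpqr : ∀ i, i = p ∨ i = q ∨ i = r) (hpq : p ≠ q) (hpr : p ≠ r) (hqr : q ≠ r) :
    ∃! m : Multiplier x, IsExtremal {p} q m := by
  obtain ⟨M, hMp, hMq, hMr, -⟩ := exists_extremal_multiplier hx hpqr hpq hpr hqr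
  refine ⟨M, (isExtremal_singleton_iff hx hpqr hpq hpr hqr M).2 ⟨hMp, hMq, hMr⟩, fun m hm => ?_⟩
  obtain ⟨hmp, hmq, hmr⟩ := (isExtremal_singleton_iff hx hpqr hpq hpr hqr m).1 hm
  refine Multiplier.ext_symbol (funext fun i => ?_)
  rcases hpqr i with rfl | rfl | rfl
  · rw [hmp, hMp]
  · rw [hmq, hMq]
  · rw [hmr, hMr]

/-- The function in `DA_n(X)` that is one at `x_0` and vanishes at the other points gives the norm
of the multipliers supported at `x_0`. -/
theorem Multiplier.norm_of_symbol_eq_zero {g : DASub x} (hg0 : (g : DA n) (x 0) = 1)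
    (hg1 : (g : DA n) (x 1) = 0) (hg2 : (g : DA n) (x 2) = 0) {m : Multiplier x}
    (h1 : m.symbol 1 = 0) (h2 : m.symbol 2 = 0) :
    ‖m‖ = ‖m.symbol 0‖ * (‖(kerVec (x 0) : DA n)‖ * ‖g‖) := by
  -- The operator has rank one: it evaluates at `x 0`, by pairing with k₀, and returns a multiple of
  -- g. Its norm is attained at k₀.
  have hop : ∀ h : DASub x, m.op h = (m.symbol 0 * inner ℂ (kerSub x 0) h) • g := by
    intro h
    refine DASub.ext_apply fun i => ?_
    rw [m.op_apply, inner_kerSub]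
    fin_cases i
    · simp [hg0]
    · simp [hg1, h1]
    · simp [hg2, h2]
  have hn : ∀ h : DASub x, ‖m.op h‖ = ‖m.symbol 0‖ * ‖inner ℂ (kerSub x 0) h‖ * ‖g‖ := by
    intro h
    rw [hop, ← norm_mul]
    exact _root_.norm_smul (m.symbol 0 * inner ℂ (kerSub x 0) h) (g : DA n)
  have hk : ‖kerSub x 0‖ = ‖(kerVec (x 0) : DA n)‖ := rfl
  have hkpos := norm_kerVec_pos (x 0)
  rw [Multiplier.norm_def]
  refine le_antisymm (ContinuousLinearMap.opNorm_le_bound _ (by positivity) fun h => ?_) ?_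
  · rw [hn]
    calc _ ≤ ‖m.symbol 0‖ * (‖kerSub x 0‖ * ‖h‖) * ‖g‖ := by
          gcongr
          exact norm_inner_le_norm (𝕜 := ℂ) (kerVec (x 0)) (h : DA n)
      _ = _ := by rw [hk]; ring
  · have h3 := m.op.le_opNorm (kerSub x 0)
    have h4 : ‖inner ℂ (kerSub x 0) (kerSub x 0)‖ = ‖(kerVec (x 0) : DA n)‖ ^ 2 := by
      change ‖inner ℂ (kerVec (x 0)) (kerVec (x 0))‖ = _
      rw [inner_self_eq_ofReal, Complex.norm_real, Real.norm_of_nonneg (sq_nonneg _)]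
    rw [hn, h4, hk] at h3
    refine le_of_mul_le_mul_right (le_of_eq_of_le ?_ h3) hkpos
    ring

theorem DASub.norm_pos_of_apply_ne_zero {g : DASub x} (hg0 : (g : DA n) (x 0) = 1) : 0 < ‖g‖ := by
  refine norm_pos_iff.2 fun h => ?_
  rw [h] at hg0
  simp at hg0

theorem DeltaG_eq (hx : Function.Injective x) {g : DASub x} (hg0 : (g : DA n) (x 0) = 1)
    (hg1 : (g : DA n) (x 1) = 0) (hg2 : (g : DA n) (x 2) = 0) :
    DeltaG x 0 1 2 = (‖(kerVec (x 0) : DA n)‖ * ‖g‖)⁻¹ := by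
  have hpos : 0 < ‖(kerVec (x 0) : DA n)‖ * ‖g‖ :=
    mul_pos (norm_kerVec_pos _) (DASub.norm_pos_of_apply_ne_zero hg0)
  refine IsGreatest.csSup_eq ⟨?_, ?_⟩
  · obtain ⟨m, hm⟩ := Multiplier.exists_symbol_eq (linearIndependent_kerVec hx)
      (fun i => if i = 0 then (((‖(kerVec (x 0) : DA n)‖ * ‖g‖)⁻¹ : ℝ) : ℂ) else 0)
    have h0 : m.symbol 0 = (((‖(kerVec (x 0) : DA n)‖ * ‖g‖)⁻¹ : ℝ) : ℂ) := by simp [hm]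
    have h1 : m.symbol 1 = 0 := by simp [hm]
    have h2 : m.symbol 2 = 0 := by simp [hm]
    refine ⟨m, h1, h2, ?_, by rw [h0, Complex.ofReal_re]⟩
    rw [Multiplier.norm_of_symbol_eq_zero hg0 hg1 hg2 h1 h2, h0, Complex.norm_real,
      Real.norm_of_nonneg (inv_nonneg.2 hpos.le), inv_mul_cancel₀ hpos.ne']
  · rintro _ ⟨m, h1, h2, hm, rfl⟩
    rw [Multiplier.norm_of_symbol_eq_zero hg0 hg1 hg2 h1 h2] at hm
    refine (Complex.re_le_norm _).trans ?_
    rwa [← one_div, le_div_iff₀ hpos]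

theorem DeltaH_eq {g : DASub x} (hg0 : (g : DA n) (x 0) = 1)
    (hg1 : (g : DA n) (x 1) = 0) (hg2 : (g : DA n) (x 2) = 0) :
    DeltaH x 0 1 2 = (‖(kerVec (x 0) : DA n)‖ * ‖g‖)⁻¹ := by
  have hpos := DASub.norm_pos_of_apply_ne_zero hg0
  have hsmul : ∀ c : ℂ, ‖c • g‖ = ‖c‖ * ‖g‖ := fun c => norm_smul c (g : DA n)
  rw [DeltaH, mul_inv, one_div]
  congr 1
  refine IsGreatest.csSup_eq ⟨?_, ?_⟩
  · refine ⟨((‖g‖⁻¹ : ℝ) : ℂ) • g, by simp [hg1], by simp [hg2], ?_, by simp [hg0]⟩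
    rw [hsmul, Complex.norm_real, Real.norm_of_nonneg (inv_nonneg.2 hpos.le),
      inv_mul_cancel₀ hpos.ne']
  · rintro _ ⟨h, h1, h2, hh, rfl⟩
    -- Functions vanishing at the other two points form the line spanned by g.
    have e : h = (h : DA n) (x 0) • g := by
      refine DASub.ext_apply fun i => ?_
      fin_cases i
      · simp [hg0]
      · simp [hg1, h1]
      · simp [hg2, h2]
    rw [e, hsmul] at hh
    refine (Complex.re_le_norm _).trans ?_
    rwa [← one_div, le_div_iff₀ hpos]

theorem isExtremal_pair_iff (hx : Function.Injective x) {g : DASub x}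
    (hg0 : (g : DA n) (x 0) = 1) (hg1 : (g : DA n) (x 1) = 0) (hg2 : (g : DA n) (x 2) = 0)
    (m : Multiplier x) : IsExtremal {1, 2} 0 m ↔
      m.symbol 0 = (((‖(kerVec (x 0) : DA n)‖ * ‖g‖)⁻¹ : ℝ) : ℂ) ∧
        m.symbol 1 = 0 ∧ m.symbol 2 = 0 := by
  have hpos : 0 < ‖(kerVec (x 0) : DA n)‖ * ‖g‖ :=
    mul_pos (norm_kerVec_pos _) (DASub.norm_pos_of_apply_ne_zero hg0)
  have hbound : ∀ m' : Multiplier x, ‖m'‖ = 1 → m'.symbol 1 = 0 → m'.symbol 2 = 0 →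
      ‖m'.symbol 0‖ ≤ (‖(kerVec (x 0) : DA n)‖ * ‖g‖)⁻¹ := by
    intro m' hm' h1 h2
    rw [Multiplier.norm_of_symbol_eq_zero hg0 hg1 hg2 h1 h2] at hm'
    rw [← one_div, le_div_iff₀ hpos, hm']
  have hone : ∀ m' : Multiplier x,
      m'.symbol 0 = (((‖(kerVec (x 0) : DA n)‖ * ‖g‖)⁻¹ : ℝ) : ℂ) → m'.symbol 1 = 0 →
      m'.symbol 2 = 0 → ‖m'‖ = 1 := by
    intro m' h0 h1 h2
    rw [Multiplier.norm_of_symbol_eq_zero hg0 hg1 hg2 h1 h2, h0, Complex.norm_real,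
      Real.norm_of_nonneg (inv_nonneg.2 hpos.le), inv_mul_cancel₀ hpos.ne']
  constructor
  · rintro ⟨⟨hm, hz⟩, hmax⟩
    have h1 : m.symbol 1 = 0 := hz 1 (Or.inl rfl)
    have h2 : m.symbol 2 = 0 := hz 2 (Or.inr rfl)
    refine ⟨eq_ofReal_of_norm_le_re (hbound m hm h1 h2) ?_, h1, h2⟩
    obtain ⟨M, hM⟩ := Multiplier.exists_symbol_eq (linearIndependent_kerVec hx)
      (fun i => if i = 0 then (((‖(kerVec (x 0) : DA n)‖ * ‖g‖)⁻¹ : ℝ) : ℂ) else 0)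
    have hM0 : M.symbol 0 = (((‖(kerVec (x 0) : DA n)‖ * ‖g‖)⁻¹ : ℝ) : ℂ) := by simp [hM]
    have hM1 : M.symbol 1 = 0 := by simp [hM]
    have hM2 : M.symbol 2 = 0 := by simp [hM]
    have h := hmax M ⟨hone M hM0 hM1 hM2, by rintro _ (rfl | rfl) <;> assumption⟩
    rwa [hM0, Complex.ofReal_re] at h
  · rintro ⟨h0, h1, h2⟩
    refine ⟨⟨hone m h0 h1 h2, by rintro _ (rfl | rfl) <;> assumption⟩, fun m' hm' => ?_⟩
    rw [h0, Complex.ofReal_re]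
    exact (Complex.re_le_norm _).trans
      (hbound m' hm'.1 (hm'.2 1 (Or.inl rfl)) (hm'.2 2 (Or.inr rfl)))

theorem existsUnique_isExtremal_pair (hx : Function.Injective x) :
    ∃! m : Multiplier x, IsExtremal {1, 2} 0 m := by
  refine (exists_apply_eq (linearIndependent_kerVec hx) fun i => if i = 0 then (1 : ℂ) else 0).elim
    fun g hg => ?_
  have hg0 : (g : DA n) (x 0) = 1 := by simp [hg]
  have hg1 : (g : DA n) (x 1) = 0 := by simp [hg]
  have hg2 : (g : DA n) (x 2) = 0 := by simp [hg]
  obtain ⟨M, hM⟩ := Multiplier.exists_symbol_eq (linearIndependent_kerVec hx)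
    (fun i => if i = 0 then (((‖(kerVec (x 0) : DA n)‖ * ‖g‖)⁻¹ : ℝ) : ℂ) else 0)
  refine ⟨M, (isExtremal_pair_iff hx hg0 hg1 hg2 M).2 (by simp [hM]), fun m hm => ?_⟩
  obtain ⟨h0, h1, h2⟩ := (isExtremal_pair_iff hx hg0 hg1 hg2 m).1 hm
  refine Multiplier.ext_symbol (funext fun i => ?_)
  rw [hM]
  fin_cases i
  · simpa using h0
  · simpa using h1
  · simpa using h2

end Extremal

theorem IsNormalFormOf.injective {n : ℕ} {y : Fin 3 → Ball n} {x : Fin 3 → Ball 2}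
    (h : IsNormalFormOf x y) (hy : Function.Injective y) : Function.Injective x := by
  obtain ⟨-, Φ, -, hΦ⟩ := h
  intro i j hij
  refine hy (Φ.injective (Ball.ext_coord fun k => ?_))
  rw [hΦ, hΦ, hij]

/-! ### Computations in normal coordinates -/

section NormalCoords

variable {x : Fin 3 → Ball 2} {s t : ℝ} {w : ℂ}

theorem HasNormalCoords.val_zero (h : HasNormalCoords x s t w) : (x 0).1 = 0 := by
  rw [h.1]
  ext i
  fin_cases i <;> rfl

theorem HasNormalCoords.moebius_zero (h : HasNormalCoords x s t w) (z : EuclideanSpace ℂ (Fin 2)) :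
    moebius (x 0).1 z = -z := by
  rw [h.val_zero]
  simp [moebius]

theorem HasNormalCoords.norm_one (h : HasNormalCoords x s t w) (hs : 0 < s) : ‖(x 1).1‖ = s := by
  have h1 := h.inner_one_one
  rw [inner_self_eq_ofReal, ← Complex.ofReal_pow, Complex.ofReal_inj] at h1
  exact (pow_left_inj₀ (norm_nonneg _) hs.le two_ne_zero).1 h1

theorem HasNormalCoords.norm_two_sq (h : HasNormalCoords x s t w) :
    ‖(x 2).1‖ ^ 2 = ‖w‖ ^ 2 + t ^ 2 := by
  have h1 := h.inner_two_two
  rwa [inner_self_eq_ofReal, Complex.ofReal_inj] at h1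

theorem HasNormalCoords.delta_zero (h : HasNormalCoords x s t w) (j : Fin 3) :
    delta x 0 j = ‖(x j).1‖ := by
  rw [delta_eq_norm_moebius, h.moebius_zero, norm_neg]

theorem HasNormalCoords.inner_kerVec_zero (h : HasNormalCoords x s t w) (j : Fin 3) :
    inner ℂ (kerVec (x 0)) (kerVec (x j)) = 1 ∧ inner ℂ (kerVec (x j)) (kerVec (x 0)) = 1 := by
  rw [inner_kerVec_kerVec, inner_kerVec_kerVec, h.inner_zero_left, h.inner_zero_right, sub_zero,
    inv_one]
  exact ⟨rfl, rfl⟩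

theorem HasNormalCoords.norm_kerVec_zero (h : HasNormalCoords x s t w) :
    ‖(kerVec (x 0) : DA 2)‖ = 1 := by
  have h1 := norm_kerVec_sq (x 0)
  rw [h.val_zero, norm_zero, zero_pow two_ne_zero, sub_zero, inv_one] at h1
  exact (pow_eq_one_iff_of_nonneg (norm_nonneg _) two_ne_zero).1 h1

theorem HasNormalCoords.classE_iff (h : HasNormalCoords x s t w) (hs : 0 < s) :
    ClassE x ↔ t = 0 := by
  constructor
  · rintro ⟨s', w', -, h'⟩
    have h1 := congrArg (fun v : EuclideanSpace ℂ (Fin 2) => v 1) (h.2.2.symm.trans h'.2.2)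
    simpa using h1
  · rintro rfl
    exact ⟨s, w, hs, h⟩

/-- Kernel entries involving the centre are 1, so the expression in the norm is 1 - 1/k₂₃ = ⟨x 1, x
2⟩ = s w (here k₂₃ pairs `x 1` with `x 2`), and δ₁₂ = s cancels the factor s. -/
theorem HasNormalCoords.LFsq_eq (h : HasNormalCoords x s t w) (hs : 0 < s) :
    LFsq x 0 1 2 = ‖w‖ ^ 2 := by
  have h1 := one_sub_inner_ne_zero (x 1).norm_lt (x 2).norm_lt
  rw [LFsq, h.delta_zero, h.norm_one hs, gram, gram, gram, gram, (h.inner_kerVec_zero 1).1,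
    (h.inner_kerVec_zero 2).2, (h.inner_kerVec_zero 0).1, inner_kerVec_kerVec, one_mul, mul_one,
    one_div (_⁻¹), inv_inv, sub_sub_cancel, h.inner_one_two, norm_mul, Complex.norm_real,
    Real.norm_of_nonneg hs.le]
  field_simp

/-- Cramer's rule: ‖g‖² is the corner entry of the inverse Gram matrix, a 2×2 minor over the full
determinant. As the kernel at the centre is 1, the determinant reduces to that of the entries k_ij -
1 = ⟨x j, x i⟩ k_ij, which gives the factor on the left. -/
theorem HasNormalCoords.norm_sq_mul_eq (h : HasNormalCoords x s t w) {g : DASub x}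
    (hg0 : (g : DA 2) (x 0) = 1) (hg1 : (g : DA 2) (x 1) = 0) (hg2 : (g : DA 2) (x 2) = 0) :
    ‖g‖ ^ 2 * (s ^ 2 * (‖w‖ ^ 2 + t ^ 2) *
        (‖(kerVec (x 1) : DA 2)‖ ^ 2 * ‖(kerVec (x 2) : DA 2)‖ ^ 2) -
        s ^ 2 * ‖w‖ ^ 2 * ‖inner ℂ (kerVec (x 1)) (kerVec (x 2))‖ ^ 2) =
      ‖(kerVec (x 1) : DA 2)‖ ^ 2 * ‖(kerVec (x 2) : DA 2)‖ ^ 2 -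
        ‖inner ℂ (kerVec (x 1)) (kerVec (x 2))‖ ^ 2 := by
  have hker : ∀ i j, inner ℂ (kerVec (x i)) (kerVec (x j)) - 1 =
      inner ℂ (x j).1 (x i).1 * inner ℂ (kerVec (x i)) (kerVec (x j)) := by
    intro i j
    have := one_sub_inner_ne_zero (x j).norm_lt (x i).norm_lt
    rw [inner_kerVec_kerVec]
    field_simp
    ring
  have h11 := hker 1 1
  have h22 := hker 2 2
  have h12 := hker 1 2
  have h21 := hker 2 1
  rw [h.inner_one_one] at h11
  rw [h.inner_two_two] at h22
  rw [h.inner_two_one] at h12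
  rw [h.inner_one_two] at h21
  obtain ⟨a, b, c, hv⟩ : ∃ a b c : ℂ, a • (kerVec (x 0) : DA 2) + b • (kerVec (x 1) : DA 2) +
      c • (kerVec (x 2) : DA 2) = (g : DA 2) := by
    refine Submodule.mem_span_triple.1 (Submodule.span_mono ?_ g.2)
    rintro _ ⟨i, rfl⟩
    fin_cases i <;> simp
  have heval : ∀ i, (g : DA 2) (x i) = a * inner ℂ (kerVec (x i)) (kerVec (x 0)) +
      b * inner ℂ (kerVec (x i)) (kerVec (x 1)) + c * inner ℂ (kerVec (x i)) (kerVec (x 2)) := by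
    intro i
    rw [← inner_kerVec, ← hv, inner_add_right, inner_add_right, inner_smul_right,
      inner_smul_right, inner_smul_right]
  -- Expanding ⟨g, g⟩ in kernels leaves only the conjugate of a, since g is 1 at `x 0` and 0
  -- elsewhere.
  have ha : a = ((‖g‖ ^ 2 : ℝ) : ℂ) := by
    have h1 : inner ℂ (g : DA 2) (g : DA 2) = ((‖g‖ ^ 2 : ℝ) : ℂ) := inner_self_eq_ofReal _
    nth_rewrite 1 [← hv] at h1
    rw [inner_add_left, inner_add_left, inner_smul_left, inner_smul_left, inner_smul_left,
      inner_kerVec, inner_kerVec, inner_kerVec, hg0, hg1, hg2, mul_zero, mul_zero, mul_one,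
      add_zero, add_zero] at h1
    have h2 := congrArg (starRingEnd ℂ) h1
    rwa [Complex.conj_conj, Complex.conj_ofReal] at h2
  have e0 := heval 0
  have e1 := heval 1
  have e2 := heval 2
  rw [hg0, (h.inner_kerVec_zero 0).1, (h.inner_kerVec_zero 1).1, (h.inner_kerVec_zero 2).1] at e0
  rw [hg1, (h.inner_kerVec_zero 1).2] at e1
  rw [hg2, (h.inner_kerVec_zero 2).2] at e2
  have hnorm : inner ℂ (kerVec (x 1)) (kerVec (x 2)) * inner ℂ (kerVec (x 2)) (kerVec (x 1)) =
      ((‖inner ℂ (kerVec (x 1)) (kerVec (x 2))‖ ^ 2 : ℝ) : ℂ) := by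
    rw [← Complex.normSq_eq_norm_sq, Complex.normSq_eq_conj_mul_self, inner_conj_symm, mul_comm]
  have hw : w * starRingEnd ℂ w = ((‖w‖ ^ 2 : ℝ) : ℂ) := by
    rw [Complex.mul_conj, Complex.normSq_eq_norm_sq]
  rw [inner_self_eq_ofReal] at h11 h22 e1 e2
  generalize inner ℂ (kerVec (x 1)) (kerVec (x 2)) = k at *
  generalize inner ℂ (kerVec (x 2)) (kerVec (x 1)) = k' at *
  rw [← Complex.ofReal_inj]
  push_cast at *
  rw [← ha, ← hnorm]
  generalize (‖(kerVec (x 1) : DA 2)‖ : ℂ) ^ 2 = K₁ at *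
  generalize (‖(kerVec (x 2) : DA 2)‖ : ℂ) ^ 2 = K₂ at *
  -- The multipliers of `e0`, `e1`, `e2` are, up to sign, the cofactors that eliminate b and c; the
  -- terms with the factor a rewrite the determinant.
  linear_combination (K₁ * K₂ - k * k') * (-e0) + (K₂ - k') * e1 - (k - K₁) * e2 +
    a * (-(h11 * (K₂ - 1) + s ^ 2 * K₁ * h22) +
      (h12 * (k' - 1) + s * starRingEnd ℂ w * k * h21) + s ^ 2 * k * k' * hw)

/-- With K = ‖k₁‖²‖k₂‖², L = |⟨k₁, k₂⟩|² and N = ‖g‖², the determinant identity reads N(s²r²K -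
s²|w|²L) = K - L. If t = 0, cancel K - L > 0. If s²r²N = 1, it reduces to L s² N t² = 0 with L, s, N
positive. -/
theorem HasNormalCoords.dual_norm_iff (h : HasNormalCoords x s t w) (hs : 0 < s)
    (hx : Function.Injective x) {g : DASub x}
    (hg0 : (g : DA 2) (x 0) = 1) (hg1 : (g : DA 2) (x 1) = 0) (hg2 : (g : DA 2) (x 2) = 0) :
    s * ‖(x 2).1‖ * ‖g‖ = 1 ↔ t = 0 := by
  have key := h.norm_sq_mul_eq hg0 hg1 hg2
  have hlt := norm_inner_kerVec_lt (hx.ne (show (1 : Fin 3) ≠ 2 by decide))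
  have hL : 0 < ‖inner ℂ (kerVec (x 1)) (kerVec (x 2))‖ ^ 2 :=
    pow_pos (norm_pos_iff.2 (inner_kerVec_ne_zero _ _)) 2
  have hN : 0 < ‖g‖ ^ 2 := pow_pos (DASub.norm_pos_of_apply_ne_zero hg0) 2
  have hsq : s * ‖(x 2).1‖ * ‖g‖ = 1 ↔ s ^ 2 * (‖w‖ ^ 2 + t ^ 2) * ‖g‖ ^ 2 = 1 := by
    rw [← h.norm_two_sq, ← mul_pow, ← mul_pow,
      pow_eq_one_iff_of_nonneg (by positivity) two_ne_zero]
  rw [hsq]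
  generalize ‖inner ℂ (kerVec (x 1)) (kerVec (x 2))‖ ^ 2 = L at *
  generalize ‖(kerVec (x 1) : DA 2)‖ ^ 2 * ‖(kerVec (x 2) : DA 2)‖ ^ 2 = K at *
  generalize ‖g‖ ^ 2 = N at *
  constructor
  · intro h1
    have h2 : (L * s ^ 2 * N) * t ^ 2 = 0 := by
      linear_combination key + (L - K) * h1
    exact pow_eq_zero_iff two_ne_zero |>.1 ((mul_eq_zero.1 h2).resolve_left (by positivity))
  · rintro rfl
    refine mul_right_cancel₀ (sub_pos.2 hlt).ne' ?_
    linear_combination key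

end NormalCoords

theorem normalForm_tfae {n : ℕ} {y : Fin 3 → Ball n} (hy : Function.Injective y)
    {x : Fin 3 → Ball 2} (h : IsNormalFormOf x y) {M₂ M₃ m₂ m₃ m₂₃ : Multiplier x}
    (hM₂ : IsExtremal {0} 1 M₂) (hM₃ : IsExtremal {0} 2 M₃)
    (hm₂ : IsExtremal {1} 0 m₂) (hm₃ : IsExtremal {2} 0 m₃) (hm₂₃ : IsExtremal {1, 2} 0 m₂₃) :
    List.TFAE
      [∃ G : Set (Ball n), IsComplexGeodesic G ∧ ∀ j, y j ∈ G,
       ClassE x,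
       LFsq x 0 1 2 = delta x 0 2 ^ 2,
       ∃ α : ℂ, ‖α‖ = 1 ∧ M₂ = α • M₃,
       m₂₃ = m₂ * m₃,
       ‖m₂ * m₃‖ = 1,
       DeltaG x 0 1 2 = delta x 0 1 * delta x 0 2,
       DeltaH x 0 1 2 = delta x 0 1 * delta x 0 2] := by
  have hx := h.injective hy
  obtain ⟨s, t, w, hs, -, hc⟩ := h.1
  refine (exists_apply_eq (linearIndependent_kerVec hx) fun i => if i = 0 then (1 : ℂ) else 0).elim
    fun g hg => ?_
  have hg0 : (g : DA 2) (x 0) = 1 := by simp [hg]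
  have hg1 : (g : DA 2) (x 1) = 0 := by simp [hg]
  have hg2 : (g : DA 2) (x 2) = 0 := by simp [hg]
  have hgpos := DASub.norm_pos_of_apply_ne_zero hg0
  have hdual := hc.dual_norm_iff hs hx hg0 hg1 hg2
  have hs' : (s : ℂ) ≠ 0 := by exact_mod_cast hs.ne'
  have hr : 0 < ‖(x 2).1‖ := by
    have := norm_moebius_pos (hx.ne (show (2 : Fin 3) ≠ 0 by decide))
    rwa [hc.moebius_zero, norm_neg] at this
  have hr' : (‖(x 2).1‖ : ℂ) ≠ 0 := by exact_mod_cast hr.ne'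
  obtain ⟨hM₂0, hM₂1, hM₂2⟩ := (isExtremal_singleton_iff hx (p := 0) (q := 1) (r := 2)
    (by decide) (by decide) (by decide) (by decide) M₂).1 hM₂
  obtain ⟨hM₃0, hM₃2, hM₃1⟩ := (isExtremal_singleton_iff hx (p := 0) (q := 2) (r := 1)
    (by decide) (by decide) (by decide) (by decide) M₃).1 hM₃
  obtain ⟨hm₂1, hm₂0, -⟩ := (isExtremal_singleton_iff hx (p := 1) (q := 0) (r := 2)
    (by decide) (by decide) (by decide) (by decide) m₂).1 hm₂
  obtain ⟨hm₃2, hm₃0, -⟩ := (isExtremal_singleton_iff hx (p := 2) (q := 0) (r := 1)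
    (by decide) (by decide) (by decide) (by decide) m₃).1 hm₃
  obtain ⟨hm₂₃0, hm₂₃1, hm₂₃2⟩ := (isExtremal_pair_iff hx hg0 hg1 hg2 m₂₃).1 hm₂₃
  rw [hc.moebius_zero, norm_neg, hc.norm_one hs] at hM₂1 hM₂2
  rw [hc.moebius_zero, norm_neg] at hM₃1 hM₃2
  rw [hc.moebius_zero, inner_neg_neg, hc.inner_one_two, mul_div_cancel_left₀ _ hs'] at hM₂2
  rw [hc.moebius_zero, inner_neg_neg, hc.inner_two_one] at hM₃1
  rw [← delta_eq_norm_moebius, delta_comm, hc.delta_zero, hc.norm_one hs] at hm₂0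
  rw [← delta_eq_norm_moebius, delta_comm, hc.delta_zero] at hm₃0
  rw [hc.norm_kerVec_zero, one_mul] at hm₂₃0
  have hp1 : (m₂ * m₃).symbol 1 = 0 := by rw [Multiplier.symbol_mul, hm₂1, zero_mul]
  have hp2 : (m₂ * m₃).symbol 2 = 0 := by rw [Multiplier.symbol_mul, hm₃2, mul_zero]
  have hp0 : (m₂ * m₃).symbol 0 = ((s * ‖(x 2).1‖ : ℝ) : ℂ) := by
    rw [Multiplier.symbol_mul, hm₂0, hm₃0, Complex.ofReal_mul]
  have hinv : ‖g‖⁻¹ = s * ‖(x 2).1‖ ↔ t = 0 := by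
    rw [← hdual, inv_eq_iff_eq_inv, ← one_div, eq_div_iff (by positivity), mul_comm]
  have t1 := h.mem_complexGeodesic_iff hs hc
  have t2 := hc.classE_iff hs
  have t3 : LFsq x 0 1 2 = delta x 0 2 ^ 2 ↔ t = 0 := by
    rw [hc.LFsq_eq hs, hc.delta_zero, hc.norm_two_sq, left_eq_add, pow_eq_zero_iff two_ne_zero]
  have t4 : (∃ α : ℂ, ‖α‖ = 1 ∧ M₂ = α • M₃) ↔ t = 0 := by
    constructor
    · rintro ⟨α, hα, rfl⟩
      rw [Multiplier.symbol_smul, hM₃2] at hM₂2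
      have h1 := congrArg norm hM₂2
      rw [norm_mul, hα, one_mul, Complex.norm_real, norm_norm] at h1
      have h2 := hc.norm_two_sq
      rw [h1, left_eq_add] at h2
      exact pow_eq_zero_iff two_ne_zero |>.1 h2
    · intro ht
      have h2 := hc.norm_two_sq
      rw [ht, zero_pow two_ne_zero, add_zero] at h2
      have h3 := (pow_left_inj₀ (norm_nonneg _) (norm_nonneg _) two_ne_zero).1 h2
      -- The phase is forced by the values w of M₂ and r of M₃ at `x 2`; it is unimodular because t
      -- = 0 gives |w| = r.
      refine ⟨w / ‖(x 2).1‖, ?_, Multiplier.ext_symbol (funext fun i => ?_)⟩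
      · rw [norm_div, Complex.norm_real, norm_norm, h3, div_self (h3 ▸ hr.ne')]
      · rw [Multiplier.symbol_smul]
        fin_cases i
        · exact hM₂0.trans (by rw [← mul_zero, ← hM₃0]; rfl)
        · refine hM₂1.trans (Eq.trans ?_ (congrArg _ hM₃1.symm))
          have h4 : w * starRingEnd ℂ w = (‖(x 2).1‖ : ℂ) ^ 2 := by
            rw [Complex.mul_conj, Complex.normSq_eq_norm_sq, h3, Complex.ofReal_pow]
          field_simp
          linear_combination -h4
        · refine hM₂2.trans (Eq.trans ?_ (congrArg _ hM₃2.symm))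
          rw [div_mul_cancel₀ _ hr']
  have t5 : m₂₃ = m₂ * m₃ ↔ t = 0 := by
    -- Both multipliers vanish at `x 1` and `x 2`, so only their values at `x 0`, namely 1/‖g‖ and s
    -- r, need comparing.
    rw [← hinv, ← Complex.ofReal_inj, ← hm₂₃0, ← hp0]
    constructor
    · intro e
      rw [e]
    · intro e
      refine Multiplier.ext_symbol (funext fun i => ?_)
      fin_cases i
      · exact e
      · exact hm₂₃1.trans hp1.symm
      · exact hm₂₃2.trans hp2.symm
  have t6 : ‖m₂ * m₃‖ = 1 ↔ t = 0 := by
    rw [Multiplier.norm_of_symbol_eq_zero hg0 hg1 hg2 hp1 hp2, hp0, Complex.norm_real,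
      Real.norm_of_nonneg (by positivity), hc.norm_kerVec_zero, one_mul, hdual]
  have t7 : DeltaG x 0 1 2 = delta x 0 1 * delta x 0 2 ↔ t = 0 := by
    rw [DeltaG_eq hx hg0 hg1 hg2, hc.norm_kerVec_zero, one_mul, hc.delta_zero, hc.delta_zero,
      hc.norm_one hs, hinv]
  have t8 : DeltaH x 0 1 2 = delta x 0 1 * delta x 0 2 ↔ t = 0 := by
    rw [DeltaH_eq hg0 hg1 hg2, hc.norm_kerVec_zero, one_mul, hc.delta_zero, hc.delta_zero,
      hc.norm_one hs, hinv]
  tfae_have 1 ↔ 2 := t1.trans t2.symm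
  tfae_have 2 ↔ 3 := t2.trans t3.symm
  tfae_have 3 ↔ 4 := t3.trans t4.symm
  tfae_have 4 ↔ 5 := t4.trans t5.symm
  tfae_have 5 ↔ 6 := t5.trans t6.symm
  tfae_have 6 ↔ 7 := t6.trans t7.symm
  tfae_have 7 ↔ 8 := t7.trans t8.symm
  tfae_finish

end DruryArveson
end

open DruryArveson
theorem proposition6p6 {n : ℕ} (y : Fin 3 → Ball n) (hy : Function.Injective y) :
    (∃! x : Fin 3 → Ball 2, IsNormalFormOf x y) ∧
    ∀ x : Fin 3 → Ball 2, IsNormalFormOf x y →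
      (∃! M₂ : Multiplier x, IsExtremal {0} 1 M₂) ∧
      (∃! M₃ : Multiplier x, IsExtremal {0} 2 M₃) ∧
      (∃! m₂ : Multiplier x, IsExtremal {1} 0 m₂) ∧
      (∃! m₃ : Multiplier x, IsExtremal {2} 0 m₃) ∧
      (∃! m₂₃ : Multiplier x, IsExtremal {1, 2} 0 m₂₃) ∧
      ∀ M₂ M₃ m₂ m₃ m₂₃ : Multiplier x,
        IsExtremal {0} 1 M₂ → IsExtremal {0} 2 M₃ →
        IsExtremal {1} 0 m₂ → IsExtremal {2} 0 m₃ → IsExtremal {1, 2} 0 m₂₃ →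
        List.TFAE
          [∃ G : Set (Ball n), IsComplexGeodesic G ∧ ∀ j, y j ∈ G,
           ClassE x,
           LFsq x 0 1 2 = delta x 0 2 ^ 2,
           ∃ α : ℂ, ‖α‖ = 1 ∧ M₂ = α • M₃,
           m₂₃ = m₂ * m₃,
           ‖m₂ * m₃‖ = 1,
           DeltaG x 0 1 2 = delta x 0 1 * delta x 0 2,
           DeltaH x 0 1 2 = delta x 0 1 * delta x 0 2] := by
  refine ⟨(exists_isNormalFormOf y hy).elim fun x hx => ⟨x, hx, fun x' hx' => hx'.unique hx⟩,
    fun x h => ?_⟩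
  have hx := h.injective hy
  exact ⟨existsUnique_isExtremal_singleton hx (r := 2) (by decide) (by decide) (by decide)
      (by decide),
    existsUnique_isExtremal_singleton hx (r := 1) (by decide) (by decide) (by decide) (by decide),
    existsUnique_isExtremal_singleton hx (r := 2) (by decide) (by decide) (by decide) (by decide),
    existsUnique_isExtremal_singleton hx (r := 1) (by decide) (by decide) (by decide) (by decide),
    existsUnique_isExtremal_pair hx,
    fun _ _ _ _ _ hM₂ hM₃ hm₂ hm₃ hm₂₃ => normalForm_tfae hy h hM₂ hM₃ hm₂ hm₃ hm₂₃⟩
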